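/- Let $1\le r\le s$ and let $p_1,\dots,p_J$ be NC $*$-polynomials in $x_1,\dots,x_s$, i.e. elements of the free unital complex algebra on the letters $x_1,x_1^*,\dots,x_s,x_s^*$. Suppose that each $p_j$ is homogeneous in $\{x_1,\dots,x_r\}$ with degree of homogeneity $d_j\ge 1$, that is, $$p_j(tx_1,\dots,tx_r,x_{r+1},\dots,x_s)=t^{d_j}\,p_j(x_1,\dots,x_s)\quad\text{for all real } t,$$ where $tx_k$ has adjoint $tx_k^*$. Let $\varepsilon>0$. Then the universal $C^*$-algebra (in the category of all, not necessarily unital, $C^*$-algebras and $*$-homomorphisms) $$C^*\left\langle x_1,\dots,x_s \;\middle|\; \|x_k\|\le 1\ (k=1,\dots,s),\ \ \|p_j(x_1,\dots,x_s)\|\le\varepsilon\ (j=1,\dots,J)\right\rangle$$ exists and is projective: for every surjective $*$-homomorphism $\rho:B\to C$ of $C^*$-algebras, every $*$-homomorphism from it to $C$ lifts along $\rho$ to a $*$-homomorphism to $B$. The same holds with the relations $\|x_k\|\le 1$ $(k=1,\dots,s)$ replaced by the single relation $\left\|\sum_{k=1}^s x_kx_k^*\right\|\le 1$, and also with them replaced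 by $\left\|\sum_{k=1}^s x_k^*x_k\right\|\le 1$. -/

import Mathlib

universe u

namespace NCSemialg

/-- Noncommutative `*`-polynomials in `x_1, …, x_s`, with complex coefficients: the free unital
complex algebra on the `2 s` letters `x_k` (the letter `Sum.inl k`) and `x_k^*` (the letter
`Sum.inr k`). -/
abbrev NCStarPoly (s : ℕ) : Type := FreeAlgebra ℂ (Fin s ⊕ Fin s)

namespace NCStarPoly

/-- The value `p(x_1, …, x_s)` of an NC `*`-polynomial at elements of a C*-algebra `A`, which need
not have a unit; it lies in the unitization of `A` (and in `A` itself when `p` has no constant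
term; the norm of the unitization extends that of `A`). -/
noncomputable def eval {s : ℕ} {A : Type u} [NonUnitalCStarAlgebra A] (x : Fin s → A) :
    NCStarPoly s →ₐ[ℂ] Unitization ℂ A :=
  FreeAlgebra.lift ℂ
    (Sum.elim (fun k => (x k : Unitization ℂ A)) (fun k => (star (x k) : A)))

/-- The substitution `p ↦ p(t x_1, …, t x_r, x_{r+1}, …, x_s)` for a real scalar `t`: it multiplies
`x_k` and `x_k^*` by `t` for the first `r` variables and fixes the other variables. -/
noncomputable def scaleFirst {s : ℕ} (r : ℕ) (t : ℝ) : NCStarPoly s →ₐ[ℂ] NCStarPoly s :=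
  FreeAlgebra.lift ℂ (Sum.elim
    (fun k => (if (k : ℕ) < r then (t : ℂ) else 1) • FreeAlgebra.ι ℂ (Sum.inl k))
    (fun k => (if (k : ℕ) < r then (t : ℂ) else 1) • FreeAlgebra.ι ℂ (Sum.inr k)))

/-- `p` is homogeneous in the first `r` variables, with degree of homogeneity `d`:
`p(t x_1, …, t x_r, x_{r+1}, …, x_s) = t ^ d p(x_1, …, x_s)` for all real `t`. -/
def IsHomogeneousInFirst {s : ℕ} (r d : ℕ) (p : NCStarPoly s) : Prop :=
  ∀ t : ℝ, scaleFirst r t p = ((t : ℂ) ^ d) • p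

end NCStarPoly

/-- A system of relations in `s` variables: it says, for each C*-algebra (with or without unit),
which `s`-tuples of its elements satisfy it. -/
abbrev CStarRelation (s : ℕ) : Type (u + 1) :=
  ∀ (A : Type u) [NonUnitalCStarAlgebra A], (Fin s → A) → Prop

/-- `P` with the generators `x_1, …, x_s` is the universal C*-algebra
`C*⟨x_1, …, x_s | R⟩`: the generators satisfy `R`, and every `s`-tuple in a C*-algebra `B`
that satisfies `R` is the image of the generators under exactly one `*`-homomorphism `P → B`. -/
structure IsUniversalCStarAlgebra {s : ℕ} (R : CStarRelation.{u} s)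
    (P : Type u) [NonUnitalCStarAlgebra P] (x : Fin s → P) : Prop where
  relation : R P x
  existsUnique_hom : ∀ (B : Type u) [NonUnitalCStarAlgebra B] (y : Fin s → B), R B y →
    ∃! φ : P →⋆ₙₐ[ℂ] B, ∀ k, φ (x k) = y k

/-- A C*-algebra `P` is projective if, for every surjective `*`-homomorphism `ρ : B → C` of
C*-algebras, every `*`-homomorphism `P → C` lifts along `ρ` to a `*`-homomorphism `P → B`. -/
def IsProjectiveCStarAlgebra (P : Type u) [NonUnitalCStarAlgebra P] : Prop :=
  ∀ (B C : Type u) [NonUnitalCStarAlgebra B] [NonUnitalCStarAlgebra C] (ρ : B →⋆ₙₐ[ℂ] C),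
    Function.Surjective ρ → ∀ φ : P →⋆ₙₐ[ℂ] C, ∃ ψ : P →⋆ₙₐ[ℂ] B, ρ.comp ψ = φ

/-- The universal C*-algebra `C*⟨x_1, …, x_s | R⟩` exists, and it (that is, every C*-algebra with
its universal property) is projective. -/
def UniversalCStarAlgebraIsProjective {s : ℕ} (R : CStarRelation.{u} s) : Prop :=
  (∃ (P : Type u) (_ : NonUnitalCStarAlgebra P) (x : Fin s → P),
    IsUniversalCStarAlgebra R P x) ∧
  ∀ (P : Type u) [NonUnitalCStarAlgebra P] (x : Fin s → P),
    IsUniversalCStarAlgebra R P x → IsProjectiveCStarAlgebra P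

/-- The relations `‖p_j(x_1, …, x_s)‖ ≤ ε` for `j = 1, …, J`. -/
def polyRelation {s J : ℕ} (p : Fin J → NCStarPoly s) (ε : ℝ) : CStarRelation.{u} s :=
  fun _ _ x => ∀ j, ‖NCStarPoly.eval x (p j)‖ ≤ ε

/-- The NC unit square: `‖x_k‖ ≤ 1` for every `k`. -/
def squareRelation (s : ℕ) : CStarRelation.{u} s :=
  fun _ _ x => ∀ k, ‖x k‖ ≤ 1

/-- The NC unit ball of row contractions: `‖∑ x_k x_k^*‖ ≤ 1`. -/
def rowBallRelation (s : ℕ) : CStarRelation.{u} s :=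
  fun _ _ x => ‖∑ k, x k * star (x k)‖ ≤ 1

/-- The NC unit ball with the adjoints on the other side: `‖∑ x_k^* x_k‖ ≤ 1`. -/
def columnBallRelation (s : ℕ) : CStarRelation.{u} s :=
  fun _ _ x => ‖∑ k, star (x k) * x k‖ ≤ 1

end NCSemialg

/-! By the universal property, projectivity amounts to lifting tuples: a tuple in `C` that satisfies
the relations must lift to one in `B` that does (`isProjectiveCStarAlgebra_of_lifting`). The
universal algebra sits in an ℓ^∞-product of C*-algebras realizing the relations; indexing the
product by norm functions on polynomials, rather than by algebras, keeps it in universe `u`.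

The square and ball relations lift by functional calculus. For such a lift b the norms ‖p_j(b)‖ may
exceed ε, but the excess (p_j(b)^* p_j(b) - ε²)_+ is killed by ρ. Take u in ker ρ with 0 ≤ u ≤ 1,
almost commuting with b and b^* and almost a unit for the excesses (`exists_quasicentral_seq`), and
multiply the first r variables by 1 - t u. The image under ρ does not change, and homogeneity gives
p_j(b') ≈ p_j(b) (1 - t u)^{d_j}. Since d_j ≥ 1, at least one factor 1 - t u is available to shrink
the excess (`norm_mul_one_sub_sq_le`).

If all norms are at most ε + δ, then t = δ / (ε + δ) brings them below ε + η for any prescribed η >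
0 (`exists_damp`), while contractions move by at most δ / ε. Halving δ at each round makes the moves
summable, and the limit satisfies the bound ε exactly (`exists_lift_norm_eval_le`). The side of the
multiplication is chosen so that the tuple stays in the square or ball. -/

namespace NCSemialg

open NCStarPoly FreeAlgebra
open scoped ENNReal

/-! ### Values of polynomials in the unitization -/

section Eval

variable {s : ℕ} {A B : Type u} [NonUnitalCStarAlgebra A] [NonUnitalCStarAlgebra B]

@[simp] lemma eval_ι_inl (x : Fin s → A) (k : Fin s) :
    eval x (ι ℂ (Sum.inl k)) = (x k : Unitization ℂ A) := by
  simp [eval]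

@[simp] lemma eval_ι_inr (x : Fin s → A) (k : Fin s) :
    eval x (ι ℂ (Sum.inr k)) = ((star (x k) : A) : Unitization ℂ A) := by
  simp [eval]

/-- Evaluation commutes with `*`-homomorphisms. -/
lemma eval_comp (φ : A →⋆ₙₐ[ℂ] B) (x : Fin s → A) (f : NCStarPoly s) :
    eval (fun k => φ (x k)) f = Unitization.starMap φ (eval x f) := by
  have : eval (fun k => φ (x k)) =
      (Unitization.starMap (R := ℂ) φ : Unitization ℂ A →ₐ[ℂ] Unitization ℂ B).comp (eval x) := by
    refine FreeAlgebra.hom_ext (funext ?_)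
    rintro (k | k) <;> simp [map_star]
  rw [this]; rfl

/-- The scalar part of a value of a polynomial is its constant term. -/
lemma fst_eval (x : Fin s → A) (f : NCStarPoly s) :
    (eval x f).fst = algebraMapInv f := by
  have : (Unitization.fstHom ℂ A).comp (eval x) = algebraMapInv := by
    refine FreeAlgebra.hom_ext (funext ?_)
    rintro (k | k) <;> simp [algebraMapInv]
  rw [← this]; rfl

lemma eval_eq_inr (x : Fin s → A) {f : NCStarPoly s} (hf : algebraMapInv f = 0) :
    eval x f = ((eval x f).snd : Unitization ℂ A) := by
  ext
  · simp [fst_eval, hf]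
  · simp

lemma norm_eval (x : Fin s → A) {f : NCStarPoly s} (hf : algebraMapInv f = 0) :
    ‖eval x f‖ = ‖(eval x f).snd‖ := by
  conv_lhs => rw [eval_eq_inr x hf]
  exact Unitization.norm_inr _

lemma snd_eval_comp (φ : A →⋆ₙₐ[ℂ] B) (x : Fin s → A) {f : NCStarPoly s}
    (hf : algebraMapInv f = 0) :
    (eval (fun k => φ (x k)) f).snd = φ (eval x f).snd := by
  rw [eval_comp, eval_eq_inr x hf]; simp

end Eval

/-- The relations `‖q_i(x)‖ ≤ c_i`. -/
def normRelation {s : ℕ} {I : Type*} (q : I → NCStarPoly s) (c : I → ℝ) : CStarRelation.{u} s :=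
  fun _ _ x => ∀ i, ‖eval x (q i)‖ ≤ c i

/-! ### Transport of norm relations -/

section NormRelation

variable {s : ℕ} {I : Type*} {q : I → NCStarPoly s} {c : I → ℝ}

lemma normRelation.map {A B : Type u} [NonUnitalCStarAlgebra A] [NonUnitalCStarAlgebra B]
    (hq : ∀ i, algebraMapInv (q i) = 0) (φ : A →⋆ₙₐ[ℂ] B) {x : Fin s → A}
    (hx : normRelation q c A x) : normRelation q c B (fun k => φ (x k)) := by
  intro i
  rw [norm_eval _ (hq i), snd_eval_comp _ _ (hq i)]
  exact (NonUnitalStarAlgHom.norm_apply_le φ _).trans ((norm_eval x (hq i)).symm.le.trans (hx i))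

/-- A family of homomorphisms that jointly controls the norm detects the relations; the intended
family is the coordinates of an ℓ^∞-product. -/
lemma normRelation.of_separating {A : Type u} [NonUnitalCStarAlgebra A] {T : Type*}
    {D : T → Type u} [∀ t, NonUnitalCStarAlgebra (D t)]
    (hq : ∀ i, algebraMapInv (q i) = 0) (hc : ∀ i, 0 ≤ c i) (φ : ∀ t, A →⋆ₙₐ[ℂ] D t)
    (hφ : ∀ (a : A) (r : ℝ), 0 ≤ r → (∀ t, ‖φ t a‖ ≤ r) → ‖a‖ ≤ r) {x : Fin s → A}
    (hx : ∀ t, normRelation q c (D t) (fun k => φ t (x k))) : normRelation q c A x := by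
  intro i
  rw [norm_eval _ (hq i)]
  refine hφ _ _ (hc i) fun t => ?_
  rw [← snd_eval_comp _ _ (hq i), ← norm_eval _ (hq i)]
  exact hx t i

end NormRelation

/-! ### Generated C*-subalgebras and homomorphisms given by graphs -/

section Closure

variable {A B : Type*} [NonUnitalCStarAlgebra A] [NonUnitalCStarAlgebra B]

/-- The C*-subalgebra generated by a set. -/
noncomputable def generated (S : Set A) : NonUnitalStarSubalgebra ℂ A :=
  (NonUnitalStarAlgebra.adjoin ℂ S).topologicalClosure

instance generated_isClosed (S : Set A) : IsClosed (generated S : Set A) :=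
  NonUnitalStarSubalgebra.isClosed_topologicalClosure _

lemma subset_generated (S : Set A) : S ⊆ generated S :=
  (NonUnitalStarAlgebra.subset_adjoin ℂ S).trans
    (NonUnitalStarSubalgebra.le_topologicalClosure _)

lemma generated_le {S : Set A} {E : NonUnitalStarSubalgebra ℂ A} (hE : IsClosed (E : Set A))
    (h : S ⊆ E) : generated S ≤ E :=
  NonUnitalStarSubalgebra.topologicalClosure_minimal _
    (NonUnitalStarAlgebra.adjoin_le h) hE

lemma continuous_starHom (φ : A →⋆ₙₐ[ℂ] B) : Continuous φ :=
  AddMonoidHomClass.continuous_of_bound φ 1 fun a => by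
    simpa using NonUnitalStarAlgHom.norm_apply_le φ a

/-- `*`-homomorphisms out of a generated C*-algebra are determined on the generators. -/
lemma generated_hom_ext {S : Set A} {φ ψ : generated S →⋆ₙₐ[ℂ] B}
    (h : ∀ a (ha : a ∈ S), φ ⟨a, subset_generated S ha⟩ = ψ ⟨a, subset_generated S ha⟩) :
    φ = ψ := by
  let i := NonUnitalStarSubalgebraClass.subtype (generated S)
  let E : NonUnitalStarSubalgebra ℂ A := (NonUnitalStarAlgHom.equalizer φ ψ).map i
  have hE : IsClosed (E : Set A) := by
    have h1 : IsClosed {a : generated S | φ a = ψ a} :=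
      isClosed_eq (continuous_starHom φ) (continuous_starHom ψ)
    have := (generated_isClosed S).isClosedEmbedding_subtypeVal.isClosedMap _ h1
    exact this
  have hle : generated S ≤ E := generated_le hE fun a ha =>
    ⟨⟨a, subset_generated S ha⟩, h a ha, rfl⟩
  ext ⟨a, ha⟩
  obtain ⟨b, hb, hba⟩ := hle ha
  have : b = ⟨a, ha⟩ := Subtype.ext hba
  exact this ▸ hb

/-- A generated C*-subalgebra of `L × B` in which the second component is dominated by the first
is the graph of a `*`-homomorphism. -/
lemma exists_hom_of_graph {L : Type*} [NonUnitalCStarAlgebra L] {K : Type*} (x : K → L)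
    (y : K → B) (h : ∀ g ∈ generated (Set.range fun k => (x k, y k)), ‖g.2‖ ≤ ‖g.1‖) :
    ∃ φ : generated (Set.range x) →⋆ₙₐ[ℂ] B,
      ∀ k, φ ⟨x k, subset_generated _ ⟨k, rfl⟩⟩ = y k := by
  let P := generated (Set.range x)
  let G := generated (Set.range fun k => (x k, y k))
  let i : G →⋆ₙₐ[ℂ] L × B := NonUnitalStarSubalgebraClass.subtype G
  let π : G →⋆ₙₐ[ℂ] L := (NonUnitalStarAlgHom.fst ℂ L B).comp i
  have hGP : G ≤ P.comap (NonUnitalStarAlgHom.fst ℂ L B) := by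
    refine generated_le ((generated_isClosed _).preimage continuous_fst) ?_
    rintro _ ⟨k, rfl⟩
    exact subset_generated _ ⟨k, rfl⟩
  let π' : G →⋆ₙₐ[ℂ] P := NonUnitalStarAlgHom.codRestrict π P fun g => hGP g.2
  -- The product norm is a maximum, so the domination hypothesis makes the first projection
  -- isometric on the graph; its range is therefore closed.
  have hiso : Isometry π := AddMonoidHomClass.isometry_of_norm π fun g =>
    (max_eq_left (h g.1 g.2)).symm
  have hrange : P ≤ NonUnitalStarAlgHom.range π := by
    refine generated_le ?_ ?_
    · have := hiso.isClosedEmbedding.isClosed_range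
      exact this
    · rintro _ ⟨k, rfl⟩
      exact ⟨⟨_, subset_generated _ ⟨k, rfl⟩⟩, rfl⟩
  have hbij : Function.Bijective π' := by
    constructor
    · intro g h hgh
      exact hiso.injective (congrArg Subtype.val hgh)
    · rintro ⟨a, ha⟩
      obtain ⟨g, hg⟩ := hrange ha
      exact ⟨g, Subtype.ext hg⟩
  let e : G ≃⋆ₐ[ℂ] P := StarAlgEquiv.ofBijective π' hbij
  let e' : P →⋆ₙₐ[ℂ] G := NonUnitalStarAlgHomClass.toNonUnitalStarAlgHom e.symm
  refine ⟨((NonUnitalStarAlgHom.snd ℂ L B).comp i).comp e', fun k => ?_⟩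
  have : e.symm ⟨x k, subset_generated _ ⟨k, rfl⟩⟩ =
      ⟨(x k, y k), subset_generated _ ⟨k, rfl⟩⟩ :=
    (e.symm_apply_eq).2 rfl
  exact congrArg (fun g : G => g.1.2) this

end Closure

/-! ### Universal C*-algebras, and projectivity as lifting of tuples -/

section Existence

/-- Evaluation at a coordinate of the `ℓ^∞`-product. -/
noncomputable def lpProj {T : Type*} (D : T → Type*) [∀ t, NonUnitalCStarAlgebra (D t)] (t : T) :
    lp D ∞ →⋆ₙₐ[ℂ] D t where
  toFun a := a t
  map_smul' _ _ := rfl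
  map_zero' := rfl
  map_add' _ _ := rfl
  map_mul' _ _ := rfl
  map_star' _ := rfl

variable {s : ℕ}

/-- The elements of the `*`-algebra generated by a tuple are values of constant free
polynomials. -/
lemma exists_eval_of_mem_adjoin {A : Type u} [NonUnitalCStarAlgebra A] (x : Fin s → A) {a : A}
    (ha : a ∈ NonUnitalStarAlgebra.adjoin ℂ (Set.range x)) :
    ∃ f : NCStarPoly s, algebraMapInv f = 0 ∧ eval x f = (a : Unitization ℂ A) := by
  have h0 (l : Fin s ⊕ Fin s) : algebraMapInv (ι ℂ l) = 0 := by simp [algebraMapInv]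
  rw [← NonUnitalStarSubalgebra.mem_toNonUnitalSubalgebra,
    NonUnitalStarAlgebra.adjoin_toNonUnitalSubalgebra] at ha
  induction ha using NonUnitalAlgebra.adjoin_induction with
  | mem a ha =>
    rcases ha with ⟨k, rfl⟩ | ⟨k, hk⟩
    · exact ⟨ι ℂ (Sum.inl k), h0 _, by simp⟩
    · exact ⟨ι ℂ (Sum.inr k), h0 _, by simp [hk]⟩
  | add a b _ _ ha hb =>
    obtain ⟨f, hf, hfa⟩ := ha
    obtain ⟨g, hg, hgb⟩ := hb
    exact ⟨f + g, by simp [hf, hg], by simp [hfa, hgb]⟩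
  | zero => exact ⟨0, by simp, by simp⟩
  | mul a b _ _ ha hb =>
    obtain ⟨f, hf, hfa⟩ := ha
    obtain ⟨g, hg, hgb⟩ := hb
    exact ⟨f * g, by simp [hf], by simp [hfa, hgb]⟩
  | smul z a _ ha =>
    obtain ⟨f, hf, hfa⟩ := ha
    exact ⟨z • f, by simp [hf], by simp [hfa]⟩

variable (R : CStarRelation.{u} s)

/-- The norm functions on polynomials that come from tuples satisfying the relation `R`. -/
def RealizedNorm : Type :=
  {N : NCStarPoly s → ℝ // ∃ (A : Type u) (_ : NonUnitalCStarAlgebra A) (x : Fin s → A),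
    R A x ∧ ∀ f, ‖eval x f‖ = N f}

namespace RealizedNorm

variable {R}

/-- A C*-algebra realizing the norm. -/
def Alg (N : RealizedNorm R) : Type u := N.2.choose

noncomputable instance (N : RealizedNorm R) : NonUnitalCStarAlgebra N.Alg :=
  N.2.choose_spec.choose

/-- The tuple realizing the norm. -/
noncomputable def gen (N : RealizedNorm R) : Fin s → N.Alg :=
  N.2.choose_spec.choose_spec.choose

lemma gen_relation (N : RealizedNorm R) : R N.Alg N.gen :=
  N.2.choose_spec.choose_spec.choose_spec.1

lemma norm_eval_gen (N : RealizedNorm R) (f : NCStarPoly s) : ‖eval N.gen f‖ = N.1 f :=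
  N.2.choose_spec.choose_spec.choose_spec.2 f

end RealizedNorm

variable {R}

/-- The tuple of all realizing tuples, in the `ℓ^∞`-product. -/
noncomputable def productGen
    (hb : ∀ (A : Type u) [NonUnitalCStarAlgebra A] (x : Fin s → A), R A x → ∀ k, ‖x k‖ ≤ 1)
    (k : Fin s) : lp (fun N : RealizedNorm R => N.Alg) ∞ :=
  ⟨fun N => N.gen k, memℓp_infty ⟨1, by
    rintro _ ⟨N, rfl⟩
    exact hb _ _ N.gen_relation k⟩⟩

/-- The values of a constant free polynomial at the universal tuple dominate its values at any
tuple that satisfies the relation. -/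
lemma norm_snd_le_norm_fst_of_mem_generated
    (hb : ∀ (A : Type u) [NonUnitalCStarAlgebra A] (x : Fin s → A), R A x → ∀ k, ‖x k‖ ≤ 1)
    {B : Type u} [NonUnitalCStarAlgebra B] {y : Fin s → B} (hy : R B y)
    {g : lp (fun N : RealizedNorm R => N.Alg) ∞ × B}
    (hg : g ∈ generated (Set.range fun k => (productGen hb k, y k))) : ‖g.2‖ ≤ ‖g.1‖ := by
  have hclosed : IsClosed {g : lp (fun N : RealizedNorm R => N.Alg) ∞ × B | ‖g.2‖ ≤ ‖g.1‖} :=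
    isClosed_le (by fun_prop) (by fun_prop)
  refine closure_minimal ?_ hclosed hg
  intro g hg
  obtain ⟨f, hf, hfg⟩ := exists_eval_of_mem_adjoin _ hg
  -- The norm function of `y` is itself an index. The algebra chosen at that index need not be `B`,
  -- but it gives every polynomial the same norm, and only norms are compared.
  let N : RealizedNorm R := ⟨fun f => ‖eval y f‖, B, inferInstance, y, hy, fun _ => rfl⟩
  have h2 : ‖eval y f‖ = ‖g.2‖ := by
    have := eval_comp (NonUnitalStarAlgHom.snd ℂ _ B) (fun k => (productGen hb k, y k)) f
    rw [hfg] at this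
    rw [show y = fun k => NonUnitalStarAlgHom.snd ℂ _ B (productGen hb k, y k) from rfl, this,
      Unitization.starMap_inr, Unitization.norm_inr]
    rfl
  have h1 : ‖eval N.gen f‖ = ‖g.1 N‖ := by
    have := eval_comp ((lpProj (fun N : RealizedNorm R => N.Alg) N).comp
      (NonUnitalStarAlgHom.fst ℂ _ B)) (fun k => (productGen hb k, y k)) f
    rw [hfg, Unitization.starMap_inr] at this
    rw [show N.gen = fun k => ((lpProj (fun N : RealizedNorm R => N.Alg) N).comp
      (NonUnitalStarAlgHom.fst ℂ _ B)) (productGen hb k, y k) from rfl, this,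
      Unitization.norm_inr]
    rfl
  calc ‖g.2‖ = ‖g.1 N‖ := by rw [← h2, ← h1, N.norm_eval_gen]
    _ ≤ ‖g.1‖ := lp.norm_apply_le_norm (by simp) _ _

/-- The universal property of the C*-algebra generated by the product tuple. -/
lemma exists_hom_generated
    (hb : ∀ (A : Type u) [NonUnitalCStarAlgebra A] (x : Fin s → A), R A x → ∀ k, ‖x k‖ ≤ 1)
    {B : Type u} [NonUnitalCStarAlgebra B] {y : Fin s → B} (hy : R B y) :
    ∃ φ : generated (Set.range (productGen hb)) →⋆ₙₐ[ℂ] B,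
      ∀ k, φ ⟨productGen hb k, subset_generated _ ⟨k, rfl⟩⟩ = y k :=
  exists_hom_of_graph (productGen hb) y fun _ hg =>
    norm_snd_le_norm_fst_of_mem_generated hb hy hg

/-- Universal C*-algebras for bounded norm relations exist. -/
theorem exists_isUniversalCStarAlgebra {I : Type*} {q : I → NCStarPoly s} {c : I → ℝ}
    (hq : ∀ i, algebraMapInv (q i) = 0) (hc : ∀ i, 0 ≤ c i)
    (hb : ∀ (A : Type u) [NonUnitalCStarAlgebra A] (x : Fin s → A),
      normRelation q c A x → ∀ k, ‖x k‖ ≤ 1) :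
    ∃ (P : Type u) (_ : NonUnitalCStarAlgebra P) (x : Fin s → P),
      IsUniversalCStarAlgebra.{u} (normRelation q c) P x := by
  refine ⟨generated (Set.range (productGen hb)), inferInstance,
    fun k => ⟨productGen hb k, subset_generated _ ⟨k, rfl⟩⟩, ?_, ?_⟩
  · refine normRelation.of_separating (D := fun N : RealizedNorm (normRelation q c) => N.Alg)
      hq hc (fun N => (lpProj _ N).comp (NonUnitalStarSubalgebraClass.subtype _)) ?_ ?_
    · intro a r hr h
      exact lp.norm_le_of_forall_le hr h
    · intro N
      exact N.gen_relation
  · intro B _ y hy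
    obtain ⟨φ, hφ⟩ := exists_hom_generated hb hy
    refine ⟨φ, hφ, fun ψ hψ => generated_hom_ext ?_⟩
    rintro _ ⟨k, rfl⟩
    exact (hψ k).trans (hφ k).symm

/-- If tuples satisfying the relations lift to such tuples, then the universal C*-algebra is
projective. -/
theorem isProjectiveCStarAlgebra_of_lifting {I : Type*} {q : I → NCStarPoly s} {c : I → ℝ}
    (hq : ∀ i, algebraMapInv (q i) = 0)
    (hlift : ∀ (B C : Type u) [NonUnitalCStarAlgebra B] [NonUnitalCStarAlgebra C]
      (ρ : B →⋆ₙₐ[ℂ] C), Function.Surjective ρ → ∀ y : Fin s → C, normRelation q c C y →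
        ∃ z : Fin s → B, normRelation q c B z ∧ ∀ k, ρ (z k) = y k)
    (P : Type u) [NonUnitalCStarAlgebra P] (x : Fin s → P)
    (hP : IsUniversalCStarAlgebra.{u} (normRelation q c) P x) : IsProjectiveCStarAlgebra P := by
  intro B C _ _ ρ hρ φ
  have hC := hP.relation.map hq φ
  obtain ⟨z, hz, hzy⟩ := hlift B C ρ hρ _ hC
  obtain ⟨ψ, hψ, -⟩ := hP.existsUnique_hom B z hz
  refine ⟨ψ, (hP.existsUnique_hom C _ hC).unique (fun k => ?_) (fun k => rfl)⟩
  simp [hψ, hzy]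

end Existence

end NCSemialg

namespace NCSemialg

open Filter Topology

/-! ### Quasi-central approximate units in a kernel -/

section QuasiCentral

attribute [local instance] CStarAlgebra.spectralOrder CStarAlgebra.spectralOrderedRing

variable {B C : Type*} [NonUnitalCStarAlgebra B] [NonUnitalCStarAlgebra C]

/-- Positivity is encoded as `star y * y`, a form that passes from a subalgebra to the ambient
algebra without comparing their orders. -/
lemma exists_approximateUnit_finite {G : Set B} (hG : G.Finite) {η : ℝ} (hη : 0 < η) :
    ∃ y : B, ‖star y * y‖ ≤ 1 ∧ ∀ g ∈ G, ‖star y * y * g - g‖ ≤ η := by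
  have happ := CStarAlgebra.increasingApproximateUnit B
  have hne := happ.neBot
  have hev : ∀ᶠ e in CStarAlgebra.approximateUnit B, ∀ g ∈ G, ‖e * g - g‖ ≤ η := by
    refine (hG.eventually_all).2 fun g hg => ?_
    exact (tendsto_iff_norm_sub_tendsto_zero.1 (happ.tendsto_mul_right g)).eventually
      (eventually_le_nhds hη)
  obtain ⟨e, he1, he2, he3⟩ :=
    (hev.and (happ.eventually_nonneg.and happ.eventually_norm)).exists
  obtain ⟨y, rfl⟩ := CStarAlgebra.nonneg_iff_eq_star_mul_self.1 he2
  exact ⟨y, he3, he1⟩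

/-- The kernel of a `*`-homomorphism contains approximate units for its finite subsets. -/
lemma exists_approximateUnit_ker (ρ : B →⋆ₙₐ[ℂ] C) {G : Set B} (hG : G.Finite)
    (hρ : ∀ g ∈ G, ρ g = 0) {η : ℝ} (hη : 0 < η) :
    ∃ e : B, ρ e = 0 ∧ 0 ≤ e ∧ ‖e‖ ≤ 1 ∧ ∀ g ∈ G, ‖e * g - g‖ ≤ η := by
  let K : NonUnitalStarSubalgebra ℂ B := NonUnitalStarAlgHom.equalizer ρ 0
  have : IsClosed (K : Set B) :=
    isClosed_eq (continuous_starHom ρ) (continuous_starHom (0 : B →⋆ₙₐ[ℂ] C))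
  obtain ⟨y, hy, hyG⟩ := exists_approximateUnit_finite (B := K)
    (hG.preimage Subtype.val_injective.injOn) hη
  exact ⟨star (y : B) * y, (star y * y).2, star_mul_self_nonneg _, hy,
    fun g hg => hyG ⟨g, hρ g hg⟩ hg⟩

/-- A sum of N successive approximate units has commutators of size O(√N), so their average is
quasi-central. Each commutator [e, b] splits as c(b) - c(b^*)^* with c(b) = e b (1 - e); `S`
accumulates the c(b). If e is almost a unit for S(b) and b^* S(b), then c(b)^* S(b) ≈ 0: the
summands have almost orthogonal ranges and their squared norms nearly add. -/
lemma exists_sum_approximateUnit (ρ : B →⋆ₙₐ[ℂ] C) {F G : Set B} (hF : F.Finite)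
    (hG : G.Finite) (hρ : ∀ g ∈ G, ρ g = 0) {M : ℝ} (hM0 : 0 ≤ M)
    (hM : ∀ b ∈ F, ‖b‖ ≤ M) {η : ℝ} (hη : 0 < η) (N : ℕ) :
    ∃ (a : B) (S : B → B), ρ a = 0 ∧ 0 ≤ a ∧ ‖a‖ ≤ N ∧ (∀ g ∈ G, ‖a * g - (N : ℂ) • g‖ ≤ N * η) ∧
      (∀ b, a * b - b * a = S b - star (S (star b))) ∧ (∀ b, ρ (S b) = 0) ∧
      ∀ b ∈ F, ‖S b‖ ^ 2 ≤ N * (4 * M ^ 2 + 1) := by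
  induction N with
  | zero => exact ⟨0, fun _ => 0, by simp⟩
  | succ N ih =>
    obtain ⟨a, S, ha, ha0, haN, hag, haS, hS, hSN⟩ := ih
    -- Chosen so that 2 M κ + κ = 1/2; the two cross terms then cost at most 1 in the squared norm.
    set κ : ℝ := 1 / (2 * (2 * M + 1)) with hκ
    have hκ0 : 0 < κ := by positivity
    obtain ⟨e, he, he0, he1, heG⟩ := exists_approximateUnit_ker ρ
      (G := G ∪ (S '' F ∪ (fun b => star b * S b) '' F))
      (hG.union ((hF.image _).union (hF.image _)))
      (by
        rintro g (hg | ⟨b, -, rfl⟩ | ⟨b, -, rfl⟩)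
        · exact hρ g hg
        · exact hS b
        · simp [hS b]) (lt_min hη hκ0)
    have hes : star e = e := (IsSelfAdjoint.of_nonneg he0).star_eq
    refine ⟨a + e, fun b => S b + (e * b - e * b * e), by simp [ha, he], add_nonneg ha0 he0,
      (norm_add_le _ _).trans (by push_cast; linarith), fun g hg => ?_, fun b => ?_, fun b => ?_,
      fun b hb => ?_⟩
    · have h1 := hag g hg
      have h2 := (heG g (Or.inl hg)).trans (min_le_left _ _)
      calc ‖(a + e) * g - ((N + 1 : ℕ) : ℂ) • g‖
          = ‖(a * g - (N : ℂ) • g) + (e * g - g)‖ := by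
            congr 1; push_cast; rw [add_mul, add_smul, one_smul]; abel
        _ ≤ N * η + η := (norm_add_le _ _).trans (add_le_add h1 h2)
        _ = ((N + 1 : ℕ) : ℝ) * η := by push_cast; ring
    · have h := haS b
      simp only [star_add, star_sub, star_mul, star_star, hes]
      calc (a + e) * b - b * (a + e) = (a * b - b * a) + (e * b - b * e) := by
            rw [add_mul, mul_add]; abel
        _ = _ := by rw [h, mul_assoc]; abel
    · simp [hS b, he]
    · have h1 : ‖e * S b - S b‖ ≤ κ :=
        (heG _ (Or.inr (Or.inl ⟨b, hb, rfl⟩))).trans (min_le_right _ _)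
      have h2 : ‖e * (star b * S b) - star b * S b‖ ≤ κ :=
        (heG _ (Or.inr (Or.inr ⟨b, hb, rfl⟩))).trans (min_le_right _ _)
      have hbM := hM b hb
      set c := e * b - e * b * e with hc
      have heb : ‖e * b‖ ≤ M := by
        refine (norm_mul_le _ _).trans ?_
        nlinarith [norm_nonneg e, norm_nonneg b]
      have hcn : ‖c‖ ≤ 2 * M := by
        refine (norm_sub_le _ _).trans ?_
        have : ‖e * b * e‖ ≤ M := by
          refine (norm_mul_le _ _).trans ?_
          nlinarith [norm_nonneg e, norm_nonneg (e * b)]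
        linarith
      have hb2 : ‖star b - e * star b‖ ≤ 2 * M := by
        refine (norm_sub_le _ _).trans ?_
        have : ‖e * star b‖ ≤ M := by
          refine (norm_mul_le _ _).trans ?_
          rw [norm_star]
          nlinarith [norm_nonneg e, norm_nonneg b]
        rw [norm_star]; linarith
      have hcS : star c * S b =
          (star b - e * star b) * (e * S b - S b) - (e * (star b * S b) - star b * S b) := by
        simp only [hc, star_sub, star_mul, hes]
        noncomm_ring
      have hcS' : ‖star c * S b‖ ≤ 1 / 2 := by
        rw [hcS]
        calc _ ≤ 2 * M * κ + κ := by
              refine (norm_sub_le _ _).trans (add_le_add ?_ h2)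
              refine (norm_mul_le _ _).trans ?_
              gcongr
          _ = 1 / 2 := by rw [hκ]; field_simp
      have hSc' : ‖star (S b) * c‖ ≤ 1 / 2 := by
        rw [← norm_star, star_mul, star_star]; exact hcS'
      have hsum : ‖S b + c‖ ^ 2 ≤ ‖S b‖ ^ 2 + 1 / 2 + (1 / 2 + ‖c‖ ^ 2) := by
        rw [pow_two ‖S b + c‖, ← CStarRing.norm_star_mul_self]
        have : star (S b + c) * (S b + c) =
            (star (S b) * S b + star (S b) * c) + (star c * S b + star c * c) := by
          rw [star_add]; noncomm_ring
        rw [this]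
        refine (norm_add_le _ _).trans (add_le_add ((norm_add_le _ _).trans ?_)
          ((norm_add_le _ _).trans ?_))
        · rw [CStarRing.norm_star_mul_self, ← pow_two]; gcongr
        · rw [CStarRing.norm_star_mul_self, ← pow_two]; gcongr
      have := hSN b hb
      push_cast
      nlinarith [norm_nonneg c]

/-- Quasi-central approximate units exist in the kernel of a `*`-homomorphism. -/
lemma exists_quasicentral (ρ : B →⋆ₙₐ[ℂ] C) {F G : Set B} (hF : F.Finite)
    (hG : G.Finite) (hρ : ∀ g ∈ G, ρ g = 0) {η : ℝ} (hη : 0 < η) :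
    ∃ u : B, ρ u = 0 ∧ 0 ≤ u ∧ ‖u‖ ≤ 1 ∧ (∀ b ∈ F, ‖u * b - b * u‖ ≤ η) ∧
      ∀ g ∈ G, ‖u * g - g‖ ≤ η := by
  -- The commutator with b involves `S` at both b and `star b`.
  have hF' : (F ∪ star '' F).Finite := hF.union (hF.image _)
  obtain ⟨M, hM⟩ := (hF'.image norm).bddAbove
  set M' := max M 0
  have hM' : ∀ b ∈ F ∪ star '' F, ‖b‖ ≤ M' := fun b hb =>
    (hM ⟨b, hb, rfl⟩).trans (le_max_left _ _)
  -- This N makes N (4 M'² + 1) ≤ (N η / 2)², so each of the two halves of the averaged commutator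
  -- is at most η / 2.
  obtain ⟨N, hN⟩ := exists_nat_gt ((4 * M' ^ 2 + 1) * 4 / η ^ 2)
  have hN0 : (0 : ℝ) < N := lt_of_le_of_lt (by positivity) hN
  have hNc : (N : ℂ) ≠ 0 := by exact_mod_cast hN0.ne'
  obtain ⟨a, S, ha, ha0, haN, hag, haS, -, hSN⟩ :=
    exists_sum_approximateUnit ρ hF' hG hρ (le_max_right _ _) hM' hη N
  have hSb (b : B) (hb : b ∈ F ∪ star '' F) : ‖S b‖ ≤ N * η / 2 := by
    refine abs_le_of_sq_le_sq' ?_ (by positivity) |>.2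
    refine (hSN b hb).trans ?_
    rw [div_lt_iff₀ (by positivity)] at hN
    nlinarith
  have hnorm : ‖((N : ℂ)⁻¹)‖ = (N : ℝ)⁻¹ := by simp
  refine ⟨(N : ℂ)⁻¹ • a, by simp [ha], ?_, ?_, fun b hb => ?_, fun g hg => ?_⟩
  · have : (N : ℂ)⁻¹ • a = (N : ℝ)⁻¹ • a := by
      rw [← Complex.coe_smul]; push_cast; rfl
    rw [this]
    exact smul_nonneg (by positivity) ha0
  · rw [norm_smul, hnorm, inv_mul_le_iff₀ hN0]; simpa using haN
  · rw [smul_mul_assoc, mul_smul_comm, ← smul_sub, norm_smul, hnorm, inv_mul_le_iff₀ hN0, haS]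
    have h1 := hSb b (Or.inl hb)
    have h2 := hSb (star b) (Or.inr ⟨b, hb, rfl⟩)
    rw [← norm_star] at h2
    exact (norm_sub_le _ _).trans (by linarith)
  · have : (N : ℂ)⁻¹ • a * g - g = (N : ℂ)⁻¹ • (a * g - (N : ℂ) • g) := by
      rw [smul_sub, smul_smul, inv_mul_cancel₀ hNc, one_smul, smul_mul_assoc]
    rw [this, norm_smul, hnorm, inv_mul_le_iff₀ hN0]
    exact hag g hg

lemma exists_quasicentral_seq (ρ : B →⋆ₙₐ[ℂ] C) {F G : Set B} (hF : F.Finite)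
    (hG : G.Finite) (hρ : ∀ g ∈ G, ρ g = 0) :
    ∃ u : ℕ → B, (∀ n, ρ (u n) = 0 ∧ 0 ≤ u n ∧ ‖u n‖ ≤ 1) ∧
      (∀ b ∈ F, Tendsto (fun n => u n * b - b * u n) atTop (𝓝 0)) ∧
      ∀ g ∈ G, Tendsto (fun n => u n * g) atTop (𝓝 g) := by
  choose u h1 h2 h3 h4 h5 using fun n : ℕ =>
    exists_quasicentral ρ hF hG hρ (Nat.one_div_pos_of_nat (α := ℝ) (n := n))
  refine ⟨u, fun n => ⟨h1 n, h2 n, h3 n⟩, fun b hb => ?_, fun g hg => ?_⟩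
  · exact squeeze_zero_norm (fun n => h4 n b hb) tendsto_one_div_add_atTop_nhds_zero_nat
  · rw [tendsto_iff_norm_sub_tendsto_zero]
    exact squeeze_zero (fun n => norm_nonneg _) (fun n => h5 n g hg)
      tendsto_one_div_add_atTop_nhds_zero_nat

end QuasiCentral

end NCSemialg

namespace NCSemialg

open NCStarPoly FreeAlgebra Filter Topology

/-! ### Homogeneous polynomials as combinations of words -/

section Words

variable {s : ℕ}

/-- The monomial given by a word in the letters. -/
noncomputable def word (w : List (Fin s ⊕ Fin s)) : NCStarPoly s := (w.map (ι ℂ)).prod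

/-- The degree of a letter in the first `r` variables. -/
def letterDegree (r : ℕ) (l : Fin s ⊕ Fin s) : ℕ :=
  if ((Sum.elim id id l : Fin s) : ℕ) < r then 1 else 0

/-- The degree of a word in the first `r` variables. -/
def wordDegree (r : ℕ) (w : List (Fin s ⊕ Fin s)) : ℕ := (w.map (letterDegree r)).sum

lemma word_cons (l : Fin s ⊕ Fin s) (w : List (Fin s ⊕ Fin s)) :
    word (l :: w) = ι ℂ l * word w := by simp [word]

lemma wordDegree_cons (r : ℕ) (l : Fin s ⊕ Fin s) (w : List (Fin s ⊕ Fin s)) :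
    wordDegree r (l :: w) = letterDegree r l + wordDegree r w := by simp [wordDegree]

lemma scaleFirst_word (r : ℕ) (t : ℝ) (w : List (Fin s ⊕ Fin s)) :
    scaleFirst r t (word w) = (t : ℂ) ^ wordDegree r w • word w := by
  induction w with
  | nil => simp [word, wordDegree]
  | cons l w ih =>
    rw [word_cons, wordDegree_cons, map_mul, ih, pow_add, mul_smul_comm, ← smul_smul,
      ← smul_mul_assoc, smul_comm]
    rcases l with k | k <;> by_cases h : (k : ℕ) < r <;>
      simp [scaleFirst, letterDegree, h, -Complex.coe_smul]

lemma basisFreeMonoid_eq_word (w : FreeMonoid (Fin s ⊕ Fin s)) :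
    FreeAlgebra.basisFreeMonoid ℂ (Fin s ⊕ Fin s) w = word w.toList := by
  simp [FreeAlgebra.basisFreeMonoid, equivMonoidAlgebraFreeMonoid, word, FreeMonoid.lift_apply]

/-- The substitution acts diagonally on words, so comparing coefficients at t = 2 alone suffices:
2^n determines n. -/
lemma mem_span_word_of_isHomogeneousInFirst {r d : ℕ} {p : NCStarPoly s}
    (hp : IsHomogeneousInFirst r d p) :
    p ∈ Submodule.span ℂ {q | ∃ w, wordDegree r w = d ∧ q = word w} := by
  let b := FreeAlgebra.basisFreeMonoid ℂ (Fin s ⊕ Fin s)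
  have key (w : FreeMonoid (Fin s ⊕ Fin s)) :
      b.coord w ∘ₗ (scaleFirst r 2).toLinearMap =
        ((2 : ℝ) : ℂ) ^ wordDegree r w.toList • b.coord w := by
    refine b.ext fun v => ?_
    have : scaleFirst r 2 (b v) = ((2 : ℝ) : ℂ) ^ wordDegree r v.toList • b v := by
      simp only [b, basisFreeMonoid_eq_word, scaleFirst_word]
    by_cases h : v = w
    · subst h
      simp [this]
    · simp [this, h]
  rw [← b.linearCombination_repr p, Finsupp.linearCombination_apply]
  refine Submodule.sum_mem _ fun w hw => Submodule.smul_mem _ _ (Submodule.subset_span ?_)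
  refine ⟨w.toList, ?_, basisFreeMonoid_eq_word w⟩
  have h := LinearMap.congr_fun (key w) p
  rw [Finsupp.mem_support_iff] at hw
  simp only [LinearMap.comp_apply, AlgHom.toLinearMap_apply, hp 2, map_smul, LinearMap.smul_apply,
    Module.Basis.coord_apply, smul_eq_mul] at h
  have h2 := mul_right_cancel₀ hw h
  have h3 : (2 : ℕ) ^ d = 2 ^ wordDegree r w.toList := by exact_mod_cast h2
  exact (Nat.pow_right_injective le_rfl h3).symm

end Words

/-! ### Asymptotic commutation with contractions -/

section Asymptotics

variable {U : Type*} [NormedRing U]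

lemma tendsto_zero_mul_of_norm_le {a b : ℕ → U} {M : ℝ} (ha : Tendsto a atTop (𝓝 0))
    (hb : ∀ n, ‖b n‖ ≤ M) : Tendsto (fun n => a n * b n) atTop (𝓝 0) := by
  refine squeeze_zero_norm (a := fun n => ‖a n‖ * M) (fun n => ?_) ?_
  · exact (norm_mul_le _ _).trans (by gcongr; exact hb n)
  · simpa using ha.norm.mul_const M

lemma tendsto_pow_mul_sub {V : ℕ → U} (hV : ∀ n, ‖V n‖ ≤ 1) {a : U}
    (ha : Tendsto (fun n => V n * a - a * V n) atTop (𝓝 0)) (d : ℕ) :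
    Tendsto (fun n => V n ^ d * a - a * V n ^ d) atTop (𝓝 0) := by
  induction d with
  | zero => simp
  | succ d ih =>
    have h1 := tendsto_zero_mul_of_norm_le ih hV
    have h2 : Tendsto (fun n => V n ^ d * (V n * a - a * V n)) atTop (𝓝 0) := by
      -- The maximum covers d = 0, where the power is 1 and its norm in `U` need not be 1.
      refine squeeze_zero_norm (a := fun n => max ‖(1 : U)‖ 1 * ‖V n * a - a * V n‖)
        (fun n => ?_) (by simpa using ha.norm.const_mul (max ‖(1 : U)‖ 1))
      refine (norm_mul_le _ _).trans ?_
      gcongr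
      rcases Nat.eq_zero_or_pos d with rfl | hd
      · simp
      · exact ((norm_pow_le' _ hd).trans (pow_le_one₀ (norm_nonneg _) (hV n))).trans
          (le_max_right _ _)
    have h := h2.add h1
    rw [add_zero] at h
    refine h.congr fun n => ?_
    rw [pow_succ]; noncomm_ring

end Asymptotics

/-! ### Asymptotic values of words and homogeneous polynomials -/

section EvalAsymptotics

variable {s r : ℕ} {B : Type u} [NonUnitalCStarAlgebra B]

/-- Each letter of the first r variables contributes a factor V on its right; asymptotic commutation
moves all of these to the far right, where they form a power given by the degree. -/
lemma tendsto_eval_word {b : Fin s → B} {b' : ℕ → Fin s → B} {V : ℕ → Unitization ℂ B}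
    (hV : ∀ n, ‖V n‖ ≤ 1)
    (hcomm : ∀ l, Tendsto (fun n => V n * eval b (ι ℂ l) - eval b (ι ℂ l) * V n) atTop (𝓝 0))
    (hlet : ∀ l, Tendsto (fun n => eval (b' n) (ι ℂ l) - eval b (ι ℂ l) * V n ^ letterDegree r l)
      atTop (𝓝 0)) (w : List (Fin s ⊕ Fin s)) :
    Tendsto (fun n => V n * eval b (word w) - eval b (word w) * V n) atTop (𝓝 0) ∧
    Tendsto (fun n => eval (b' n) (word w) - eval b (word w) * V n ^ wordDegree r w)
      atTop (𝓝 0) := by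
  have hVd (d n : ℕ) : ‖V n ^ d‖ ≤ 1 :=
    (norm_pow_le _ _).trans (pow_le_one₀ (norm_nonneg _) (hV n))
  induction w with
  | nil => simp [word, wordDegree]
  | cons l w ih =>
    obtain ⟨ih1, ih2⟩ := ih
    constructor
    · have h := ((hcomm l).mul_const (eval b (word w))).add (ih1.const_mul (eval b (ι ℂ l)))
      rw [zero_mul, mul_zero, add_zero] at h
      refine h.congr fun n => ?_
      rw [word_cons, map_mul]; noncomm_ring
    -- With X ≈ x for the letter and Y ≈ y for the rest, XY - xy is expanded as (X-x)(Y-y) + x(Y-y)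
    -- + (X-x)y; the fourth term commutes the letter's power of V past the rest.
    · have h1 := (hlet l).mul ih2
      have h2 : Tendsto (fun n => eval b (ι ℂ l) * (V n ^ letterDegree r l *
          (eval (b' n) (word w) - eval b (word w) * V n ^ wordDegree r w))) atTop (𝓝 0) := by
        have : Tendsto (fun n => V n ^ letterDegree r l *
            (eval (b' n) (word w) - eval b (word w) * V n ^ wordDegree r w)) atTop (𝓝 0) := by
          refine squeeze_zero_norm (fun n => (norm_mul_le _ _).trans
            (mul_le_of_le_one_left (norm_nonneg _) (hVd _ n))) (by simpa using ih2.norm)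
        simpa using this.const_mul (eval b (ι ℂ l))
      have h3 : Tendsto (fun n => (eval (b' n) (ι ℂ l) - eval b (ι ℂ l) * V n ^ letterDegree r l) *
          (eval b (word w) * V n ^ wordDegree r w)) atTop (𝓝 0) := by
        refine tendsto_zero_mul_of_norm_le (M := ‖eval b (word w)‖) (hlet l) fun n => ?_
        exact (norm_mul_le _ _).trans (mul_le_of_le_one_right (norm_nonneg _) (hVd _ n))
      have h4 : Tendsto (fun n => eval b (ι ℂ l) * ((V n ^ letterDegree r l * eval b (word w) -
          eval b (word w) * V n ^ letterDegree r l) * V n ^ wordDegree r w)) atTop (𝓝 0) := by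
        have := tendsto_zero_mul_of_norm_le (tendsto_pow_mul_sub hV ih1 (letterDegree r l))
          (hVd (wordDegree r w))
        simpa using this.const_mul (eval b (ι ℂ l))
      have h := ((h1.add h2).add h3).add h4
      simp only [mul_zero, add_zero] at h
      refine h.congr fun n => ?_
      rw [word_cons, wordDegree_cons, map_mul, map_mul, pow_add]; noncomm_ring

/-- Asymptotically, damping the first `r` variables of a homogeneous polynomial by `V n` damps its
value by the power of `V n` given by the degree. -/
lemma tendsto_eval_of_isHomogeneousInFirst {b : Fin s → B} {b' : ℕ → Fin s → B}
    {V : ℕ → Unitization ℂ B} (hV : ∀ n, ‖V n‖ ≤ 1)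
    (hcomm : ∀ l, Tendsto (fun n => V n * eval b (ι ℂ l) - eval b (ι ℂ l) * V n) atTop (𝓝 0))
    (hlet : ∀ l, Tendsto (fun n => eval (b' n) (ι ℂ l) - eval b (ι ℂ l) * V n ^ letterDegree r l)
      atTop (𝓝 0)) {d : ℕ} {p : NCStarPoly s} (hp : IsHomogeneousInFirst r d p) :
    Tendsto (fun n => eval (b' n) p - eval b p * V n ^ d) atTop (𝓝 0) := by
  have hspan := mem_span_word_of_isHomogeneousInFirst hp
  clear hp
  induction hspan using Submodule.span_induction with
  | mem q hq =>
    obtain ⟨w, rfl, rfl⟩ := hq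
    exact (tendsto_eval_word hV hcomm hlet w).2
  | zero => simp
  | add p q _ _ ihp ihq =>
    have h := ihp.add ihq
    rw [add_zero] at h
    refine h.congr fun n => ?_
    rw [map_add, map_add]; noncomm_ring
  | smul z p _ ihp =>
    have h := ihp.const_smul z
    rw [smul_zero] at h
    refine h.congr fun n => ?_
    rw [map_smul, map_smul, smul_sub, smul_mul_assoc]

/-- The value of a polynomial depends continuously on the tuple. -/
lemma continuous_eval (p : NCStarPoly s) : Continuous fun b : Fin s → B => eval b p := by
  induction p using FreeAlgebra.induction with
  | grade0 z => simp only [AlgHom.commutes]; exact continuous_const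
  | grade1 l =>
    rcases l with k | k
    · simp only [eval_ι_inl]
      exact (Unitization.isometry_inr (𝕜 := ℂ)).continuous.comp (continuous_apply k)
    · simp only [eval_ι_inr]
      exact (Unitization.isometry_inr (𝕜 := ℂ)).continuous.comp (continuous_apply k).star
  | mul p q hp hq => simp only [map_mul]; exact hp.mul hq
  | add p q hp hq => simp only [map_add]; exact hp.add hq

end EvalAsymptotics

end NCSemialg

namespace NCSemialg

open Filter Topology

/-! ### Norm reduction by functional calculus -/

section NormReduction

attribute [local instance] CStarAlgebra.spectralOrder CStarAlgebra.spectralOrderedRing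

variable {U W : Type*} [CStarAlgebra U] [CStarAlgebra W]

/-- The positive part of `y^* y - ε ^ 2`. -/
noncomputable def excess (ε : ℝ) (y : U) : U := cfc (fun x : ℝ => max (x - ε ^ 2) 0) (star y * y)

lemma excess_nonneg (ε : ℝ) (y : U) : 0 ≤ excess ε y := cfc_nonneg fun _ _ => le_max_right _ _

lemma star_mul_self_le_add_excess (ε : ℝ) (y : U) :
    star y * y ≤ algebraMap ℝ U (ε ^ 2) + excess ε y := by
  rw [excess, ← cfc_const_add (ε ^ 2) (fun x : ℝ => max (x - ε ^ 2) 0) (star y * y)]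
  conv_lhs => rw [← cfc_id' ℝ (star y * y)]
  exact cfc_mono fun x _ => by linarith [le_max_left (x - ε ^ 2) 0]

lemma le_norm_sq_of_mem_spectrum_star_mul_self {y : U} {x : ℝ}
    (hx : x ∈ spectrum ℝ (star y * y)) : x ≤ ‖y‖ ^ 2 := by
  cases subsingleton_or_nontrivial U
  · simp [spectrum.of_subsingleton] at hx
  have := spectrum.norm_le_norm_of_mem hx
  rw [CStarRing.norm_star_mul_self, ← pow_two] at this
  exact (Real.le_norm_self x).trans this

lemma excess_le {ε R : ℝ} {y : U} (hR : ε ^ 2 ≤ R) (hy : ‖y‖ ^ 2 ≤ R) :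
    excess ε y ≤ algebraMap ℝ U (R - ε ^ 2) :=
  cfc_le_algebraMap _ _ _ fun x hx => max_le
    (by linarith [le_norm_sq_of_mem_spectrum_star_mul_self hx]) (by linarith)

/-- The spectrum of Φ(y)^* Φ(y) lies below ε², where the function defining the excess vanishes. This
puts the excess in the kernel, where approximate units are available. -/
lemma map_excess_eq_zero (Φ : U →⋆ₐ[ℂ] W) {ε : ℝ} (hε : 0 ≤ ε) {y : U} (hy : ‖Φ y‖ ≤ ε) :
    Φ (excess ε y) = 0 := by
  have hΦ : Continuous Φ := continuous_starHom Φ.toNonUnitalStarAlgHom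
  rw [excess, Φ.map_cfc (S := ℂ) _ _ (by fun_prop) hΦ (IsSelfAdjoint.star_mul_self y)
    ((IsSelfAdjoint.star_mul_self y).map Φ), map_mul, map_star]
  have : cfc (fun x : ℝ => max (x - ε ^ 2) 0) (star (Φ y) * Φ y) =
      cfc (fun _ => (0 : ℝ)) (star (Φ y) * Φ y) := by
    refine cfc_congr fun x hx => max_eq_right ?_
    have := le_norm_sq_of_mem_spectrum_star_mul_self hx
    nlinarith [norm_nonneg (Φ y)]
  rw [this, cfc_const_zero ℝ _]

/-- Damping by an approximate unit for the excess of `y` over `ε` brings the norm of `y` down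
to about `ε`. -/
lemma norm_mul_one_sub_sq_le {y u : U} {ε R t : ℝ} (hR : ε ^ 2 < R) (hy : ‖y‖ ^ 2 ≤ R)
    (ht0 : 0 ≤ t) (ht1 : t ≤ 1) (ht : (1 - t) ^ 2 * R ≤ ε ^ 2) (hu0 : 0 ≤ u) (hu1 : u ≤ 1) :
    ‖y * (1 - t • u)‖ ^ 2 ≤ ε ^ 2 +
      ‖(t ^ 2 - ε ^ 2 * (2 * t - t ^ 2) / (R - ε ^ 2)) • (u * excess ε y * u - excess ε y) -
        t • (u * excess ε y - excess ε y) - t • (excess ε y * u - excess ε y)‖ := by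
  set g := excess ε y
  set m := 2 * t - t ^ 2 with hm
  have hm0 : 0 ≤ m := by nlinarith
  set D := R - ε ^ 2 with hD
  have hD0 : 0 < D := by linarith
  set E := (t ^ 2 - ε ^ 2 * m / D) • (u * g * u - g) - t • (u * g - g) - t • (g * u - g) with hE
  have hus : star u = u := (IsSelfAdjoint.of_nonneg hu0).star_eq
  have hgs : star g = g := (IsSelfAdjoint.of_nonneg (excess_nonneg ε y)).star_eq
  set V := 1 - t • u with hV
  have hVs : star V = V := by simp [hV, hus]
  have h1 : V * (star y * y) * V ≤ V * (algebraMap ℝ U (ε ^ 2) + g) * V := by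
    have := star_left_conjugate_le_conjugate (star_mul_self_le_add_excess ε y) V
    rwa [hVs] at this
  have h2 : u * g * u ≤ D • (u * u) := by
    have := star_left_conjugate_le_conjugate (excess_le hR.le hy) u
    rw [hus] at this
    refine this.trans_eq ?_
    rw [Algebra.algebraMap_eq_smul_one, mul_smul_comm, mul_one, smul_mul_assoc]
  have h3 : u * u ≤ u := by
    have := CStarAlgebra.pow_antitone hu0 hu1 one_le_two
    simpa [pow_two] using this
  -- Bounding ε² V² by ε² would leave a positive remainder ≈ (1 - t)² g. A gain proportional to g is
  -- extracted instead: V² ≤ 1 - m u², and g ≤ D turns u² into u g u / D.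
  have h4 : V * V ≤ 1 - (m / D) • (u * g * u) := by
    have h5 : (m / D) • (u * g * u) ≤ m • (u * u) := by
      have := smul_le_smul_of_nonneg_left h2 (div_nonneg hm0 hD0.le)
      rwa [smul_smul, div_mul_cancel₀ _ hD0.ne'] at this
    have h6 : V * V = 1 - m • (u * u) - (2 * t) • (u - u * u) := by
      rw [hV, hm]
      simp only [sub_mul, mul_sub, one_mul, mul_one, smul_mul_assoc, mul_smul_comm]
      module
    have h7 : 0 ≤ (2 * t) • (u - u * u) := smul_nonneg (by linarith) (sub_nonneg.2 h3)
    rw [h6]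
    calc 1 - m • (u * u) - (2 * t) • (u - u * u) ≤ 1 - m • (u * u) := sub_le_self _ h7
      _ ≤ _ := sub_le_sub_left h5 _
  have h8 : (ε ^ 2) • (V * V) ≤ (ε ^ 2) • (1 - (m / D) • (u * g * u)) :=
    smul_le_smul_of_nonneg_left h4 (sq_nonneg ε)
  have h9 : V * (algebraMap ℝ U (ε ^ 2) + g) * V = (ε ^ 2) • (V * V) + V * g * V := by
    rw [Algebra.algebraMap_eq_smul_one, mul_add, add_mul, mul_smul_comm, mul_one, smul_mul_assoc]
  -- E collects the errors made by replacing u g, g u and u g u by g.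
  have h10 : (ε ^ 2) • (1 - (m / D) • (u * g * u)) + V * g * V =
      algebraMap ℝ U (ε ^ 2) + ((1 - t) ^ 2 - ε ^ 2 * m / D) • g + E := by
    rw [hE, hV, Algebra.algebraMap_eq_smul_one]
    simp only [sub_mul, mul_sub, one_mul, mul_one, smul_mul_assoc, mul_smul_comm]
    rw [mul_div_assoc]
    module
  -- As m = 1 - (1 - t)², nonpositivity of this coefficient is the hypothesis (1 - t)² R ≤ ε².
  have h11 : ((1 - t) ^ 2 - ε ^ 2 * m / D) • g ≤ 0 := by
    refine smul_nonpos_of_nonpos_of_nonneg ?_ (excess_nonneg ε y)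
    rw [sub_nonpos, le_div_iff₀ hD0, hD, hm]
    nlinarith
  have hEs : IsSelfAdjoint E := by
    rw [isSelfAdjoint_iff, hE]
    simp only [star_sub, star_smul, star_mul, hus, hgs, star_trivial, mul_assoc]
    abel
  have h12 : V * (star y * y) * V ≤ algebraMap ℝ U (ε ^ 2 + ‖E‖) := by
    calc V * (star y * y) * V ≤ algebraMap ℝ U (ε ^ 2) + ((1 - t) ^ 2 - ε ^ 2 * m / D) • g + E := by
          rw [← h10]; exact h1.trans (h9.trans_le (add_le_add_left h8 _))
      _ ≤ algebraMap ℝ U (ε ^ 2) + 0 + algebraMap ℝ U ‖E‖ :=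
          add_le_add (add_le_add_right h11 _) hEs.le_algebraMap_norm_self
      _ = _ := by rw [add_zero, map_add]
  have h13 : star (y * V) * (y * V) = V * (star y * y) * V := by
    rw [star_mul, hVs]; noncomm_ring
  rw [pow_two ‖y * V‖, ← CStarRing.norm_star_mul_self, CStarAlgebra.norm_le_iff_le_algebraMap _
    (by positivity) (star_mul_self_nonneg _), h13]
  exact h12

lemma eventually_norm_mul_one_sub_le {y : U} {u : ℕ → U} {ε δ t : ℝ} (hε : 0 < ε) (hδ : 0 < δ)
    (hy : ‖y‖ ≤ ε + δ) (ht0 : 0 ≤ t) (ht1 : t ≤ 1) (ht : (1 - t) * (ε + δ) ≤ ε)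
    (hu : ∀ n, 0 ≤ u n ∧ ‖u n‖ ≤ 1)
    (hg : Tendsto (fun n => u n * excess ε y) atTop (𝓝 (excess ε y))) {η : ℝ} (hη : 0 < η) :
    ∀ᶠ n in atTop, ‖y * (1 - (t : ℂ) • u n)‖ ≤ ε + η := by
  set g := excess ε y
  have hgs : star g = g := (IsSelfAdjoint.of_nonneg (excess_nonneg ε y)).star_eq
  have h1 : Tendsto (fun n => u n * g - g) atTop (𝓝 0) := by
    simpa using hg.sub_const g
  have h2 : Tendsto (fun n => g * u n - g) atTop (𝓝 0) := by
    have := h1.star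
    simpa [hgs, fun n => (IsSelfAdjoint.of_nonneg (hu n).1).star_eq] using this
  have h3 : Tendsto (fun n => u n * g * u n - g) atTop (𝓝 0) := by
    have := (tendsto_zero_mul_of_norm_le h1 fun n => (hu n).2).add h2
    simp only [add_zero] at this
    refine this.congr fun n => ?_
    noncomm_ring
  have h4 := ((h3.const_smul (t ^ 2 - ε ^ 2 * (2 * t - t ^ 2) / ((ε + δ) ^ 2 - ε ^ 2))).sub
    (h1.const_smul t)).sub (h2.const_smul t)
  have h5 := h4.norm
  simp only [smul_zero, sub_zero, norm_zero] at h5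
  filter_upwards [h5.eventually (eventually_le_nhds (pow_pos hη 2))] with n hn
  rw [Complex.coe_smul]
  refine abs_le_of_sq_le_sq' ?_ (by positivity) |>.2
  refine (norm_mul_one_sub_sq_le (ε := ε) (R := (ε + δ) ^ 2) (by nlinarith)
    (pow_le_pow_left₀ (norm_nonneg y) hy 2) ht0 ht1 ?_
    (hu n).1 ((CStarAlgebra.norm_le_one_iff_of_nonneg _ (hu n).1).1 (hu n).2)).trans ?_
  · rw [← mul_pow]
    exact pow_le_pow_left₀ (mul_nonneg (by linarith) (by positivity)) ht 2
  · nlinarith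

/-- The function `x ↦ 1 / √(max 1 x)`, by which elements are cut down to contractions. -/
noncomputable def cutoff (x : ℝ) : ℝ := (√(max 1 x))⁻¹

lemma continuous_cutoff : Continuous cutoff := by
  refine Continuous.inv₀ (by fun_prop) fun x => ?_
  exact (Real.sqrt_pos.2 (lt_of_lt_of_le one_pos (le_max_left 1 x))).ne'

lemma cutoff_eq_one {x : ℝ} (hx : x ≤ 1) : cutoff x = 1 := by simp [cutoff, hx]

lemma cutoff_mul_mul_cutoff {x : ℝ} (hx : 0 ≤ x) : ‖cutoff x * x * cutoff x‖ ≤ 1 := by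
  have h : 0 < max 1 x := lt_of_lt_of_le one_pos (le_max_left 1 x)
  have : cutoff x * x * cutoff x = x / max 1 x := by
    rw [cutoff, mul_right_comm, ← mul_inv, Real.mul_self_sqrt h.le]; field_simp
  rw [this, Real.norm_of_nonneg (by positivity), div_le_one h]
  exact le_max_right _ _

lemma norm_cutoff_conjugate_le {h : U} (hh : 0 ≤ h) :
    ‖cfc cutoff h * h * cfc cutoff h‖ ≤ 1 := by
  have hc := continuous_cutoff.continuousOn (s := spectrum ℝ h)
  have : cfc cutoff h * h * cfc cutoff h = cfc (fun x => cutoff x * x * cutoff x) h := by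
    rw [cfc_mul (fun x => cutoff x * x) cutoff h (hc.mul continuousOn_id) hc,
      cfc_mul cutoff (fun x => x) h hc continuousOn_id, cfc_id' ℝ h]
  rw [this]
  exact norm_cfc_le zero_le_one fun x hx =>
    cutoff_mul_mul_cutoff (spectrum_nonneg_of_nonneg hh hx)

lemma map_cutoff_eq_one (Φ : U →⋆ₐ[ℂ] W) {h : U} (hh : 0 ≤ h) (hΦh : ‖Φ h‖ ≤ 1) :
    Φ (cfc cutoff h) = 1 := by
  have hΦ : Continuous Φ := continuous_starHom Φ.toNonUnitalStarAlgHom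
  have hs : IsSelfAdjoint (Φ h) := (IsSelfAdjoint.of_nonneg hh).map Φ
  rw [Φ.map_cfc (S := ℂ) _ _ continuous_cutoff.continuousOn hΦ (IsSelfAdjoint.of_nonneg hh) hs]
  have : cfc cutoff (Φ h) = cfc (fun _ => (1 : ℝ)) (Φ h) := by
    refine cfc_congr fun x hx => cutoff_eq_one ?_
    cases subsingleton_or_nontrivial W
    · simp [spectrum.of_subsingleton] at hx
    exact ((Real.le_norm_self x).trans (spectrum.norm_le_norm_of_mem hx)).trans hΦh
  rw [this, cfc_const_one ℝ _]

end NormReduction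

/-! ### Lifting row and column contractions -/

section ContractionLift

attribute [local instance] CStarAlgebra.spectralOrder CStarAlgebra.spectralOrderedRing

variable {B C : Type*} [NonUnitalCStarAlgebra B] [NonUnitalCStarAlgebra C]

/-- Column contractions lift to column contractions. -/
lemma exists_columnContraction_lift {K : Type*} [Fintype K] (ρ : B →⋆ₙₐ[ℂ] C)
    (hρ : Function.Surjective ρ) {c : K → C} (hc : ‖∑ k, star (c k) * c k‖ ≤ 1) :
    ∃ b : K → B, (∀ k, ρ (b k) = c k) ∧ ‖∑ k, star (b k) * b k‖ ≤ 1 := by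
  choose b hb using fun k => hρ (c k)
  set h : Unitization ℂ B := ∑ k, star (b k : Unitization ℂ B) * (b k : Unitization ℂ B) with hh
  have hh0 : 0 ≤ h := Finset.sum_nonneg fun k _ => star_mul_self_nonneg _
  -- Replacing b_k by b_k z turns h into z h z, of norm at most 1; the image of z is 1 because the
  -- image of h already has norm at most 1.
  set z := cfc cutoff h
  have hz : star z = z := (cfc_predicate cutoff h : IsSelfAdjoint z).star_eq
  have hΦz : Unitization.starMap ρ z = 1 := by
    refine map_cutoff_eq_one _ hh0 ?_
    rw [hh, map_sum]
    simp only [map_mul, map_star, Unitization.starMap_inr, hb]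
    have : (∑ k, star (c k : Unitization ℂ C) * (c k : Unitization ℂ C)) =
        ((∑ k, star (c k) * c k : C) : Unitization ℂ C) := by
      rw [← Unitization.inrHom_apply ℂ, map_sum]
      simp
    rw [this, Unitization.norm_inr]
    exact hc
  have hinr (k : K) : (((b k : Unitization ℂ B) * z).snd : Unitization ℂ B) =
      (b k : Unitization ℂ B) * z := by
    ext <;> simp
  refine ⟨fun k => ((b k : Unitization ℂ B) * z).snd, fun k => ?_, ?_⟩
  · refine Unitization.inr_injective (R := ℂ) ?_
    rw [← Unitization.starMap_inr, hinr, map_mul, hΦz, mul_one, Unitization.starMap_inr, hb]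
  · rw [← Unitization.norm_inr (𝕜 := ℂ)]
    have : ((∑ k, star ((b k : Unitization ℂ B) * z).snd * ((b k : Unitization ℂ B) * z).snd : B) :
        Unitization ℂ B) = z * h * z := by
      rw [hh, Finset.mul_sum, Finset.sum_mul, ← Unitization.inrHom_apply ℂ, map_sum]
      refine Finset.sum_congr rfl fun k _ => ?_
      rw [Unitization.inrHom_apply, Unitization.inr_mul, Unitization.inr_star, hinr, star_mul, hz]
      noncomm_ring
    rw [this]
    exact norm_cutoff_conjugate_le hh0

/-- Row contractions lift to row contractions. -/
lemma exists_rowContraction_lift {K : Type*} [Fintype K] (ρ : B →⋆ₙₐ[ℂ] C)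
    (hρ : Function.Surjective ρ) {c : K → C} (hc : ‖∑ k, c k * star (c k)‖ ≤ 1) :
    ∃ b : K → B, (∀ k, ρ (b k) = c k) ∧ ‖∑ k, b k * star (b k)‖ ≤ 1 := by
  obtain ⟨b, hb, hb1⟩ := exists_columnContraction_lift ρ hρ (c := fun k => star (c k))
    (by simpa using hc)
  exact ⟨fun k => star (b k), fun k => by simp [map_star, hb], by simpa using hb1⟩

/-- Contractions lift to contractions. -/
lemma exists_contraction_lift (ρ : B →⋆ₙₐ[ℂ] C) (hρ : Function.Surjective ρ) {c : C}
    (hc : ‖c‖ ≤ 1) : ∃ b : B, ρ b = c ∧ ‖b‖ ≤ 1 := by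
  obtain ⟨b, hb, hb1⟩ := exists_columnContraction_lift ρ hρ (c := fun _ : Unit => c)
    (by simpa [CStarRing.norm_star_mul_self] using mul_le_one₀ hc (norm_nonneg _) hc)
  refine ⟨b (), hb (), ?_⟩
  simp only [Finset.univ_unique, Finset.sum_singleton, CStarRing.norm_star_mul_self] at hb1
  nlinarith [norm_nonneg (b ())]

end ContractionLift

end NCSemialg

namespace NCSemialg

open NCStarPoly FreeAlgebra Filter Topology

/-! ### Damping by kernel elements and the limiting argument -/

section Damping

attribute [local instance] CStarAlgebra.spectralOrder CStarAlgebra.spectralOrderedRing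

variable {s : ℕ} {B C : Type u} [NonUnitalCStarAlgebra B] [NonUnitalCStarAlgebra C]

/-- Multiply the first `r` entries of a tuple by `1 - t u`, on the left or on the right. -/
noncomputable def damp (left : Bool) (r : ℕ) (t : ℝ) (u : B) (b : Fin s → B) : Fin s → B :=
  fun k => if (k : ℕ) < r then b k - (t : ℂ) • (bif left then u * b k else b k * u) else b k

lemma map_damp (ρ : B →⋆ₙₐ[ℂ] C) (left : Bool) (r : ℕ) (t : ℝ) {u : B} (hu : ρ u = 0)
    (b : Fin s → B) (k : Fin s) : ρ (damp left r t u b k) = ρ (b k) := by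
  by_cases h : (k : ℕ) < r <;> cases left <;> simp [damp, h, hu, -Complex.coe_smul]

lemma norm_damp_sub_le (left : Bool) (r : ℕ) {t : ℝ} (ht : 0 ≤ t) {u : B} (hu : ‖u‖ ≤ 1)
    (b : Fin s → B) (k : Fin s) : ‖damp left r t u b k - b k‖ ≤ t * ‖b k‖ := by
  have h1 : ‖u * b k‖ ≤ ‖b k‖ :=
    (norm_mul_le _ _).trans (mul_le_of_le_one_left (norm_nonneg _) hu)
  have h2 : ‖b k * u‖ ≤ ‖b k‖ :=
    (norm_mul_le _ _).trans (mul_le_of_le_one_right (norm_nonneg _) hu)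
  by_cases h : (k : ℕ) < r
  · cases left <;> simp only [damp, h, if_true, sub_sub_cancel_left, norm_neg, norm_smul,
      Complex.norm_real, Real.norm_of_nonneg ht, cond_true, cond_false] <;> gcongr
  · simp only [damp, h, if_false, sub_self, norm_zero]
    positivity

/-- Of a damped variable and its adjoint, one carries 1 - t u on the right exactly; the other does
so up to t times a commutator. -/
lemma tendsto_damp_letter (left : Bool) (r : ℕ) (t : ℝ) {u : ℕ → B} (hu : ∀ n, star (u n) = u n)
    (b : Fin s → B)
    (hc : ∀ k, Tendsto (fun n => u n * b k - b k * u n) atTop (𝓝 0))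
    (hc' : ∀ k, Tendsto (fun n => u n * star (b k) - star (b k) * u n) atTop (𝓝 0))
    (l : Fin s ⊕ Fin s) :
    Tendsto (fun n => eval (damp left r t (u n) b) (ι ℂ l) -
      eval b (ι ℂ l) * (1 - (t : ℂ) • (u n : Unitization ℂ B)) ^ letterDegree r l)
      atTop (𝓝 0) := by
  have key {f : ℕ → B} (hf : Tendsto f atTop (𝓝 0)) :
      Tendsto (fun n => -((t : ℂ) • (f n : Unitization ℂ B))) atTop (𝓝 0) := by
    have h1 := ((Unitization.isometry_inr (𝕜 := ℂ) (A := B)).continuous.tendsto 0).comp hf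
    simpa using (h1.const_smul (t : ℂ)).neg
  rcases l with k | k
  · simp only [eval_ι_inl]
    by_cases h : (k : ℕ) < r
    · cases left
      · refine tendsto_const_nhds.congr fun n => ?_
        simp [damp, letterDegree, h, mul_sub, -Complex.coe_smul]
      · refine (key (hc k)).congr fun n => ?_
        simp only [damp, letterDegree, h, if_true, cond_true, Sum.elim_inl, id, pow_one,
          Unitization.inr_sub, Unitization.inr_smul, Unitization.inr_mul, mul_sub, mul_one,
          mul_smul_comm, smul_sub]
        abel
    · refine tendsto_const_nhds.congr fun n => ?_
      simp [damp, letterDegree, h]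
  · simp only [eval_ι_inr]
    by_cases h : (k : ℕ) < r
    · cases left
      · refine (key (hc' k)).congr fun n => ?_
        simp only [damp, letterDegree, h, if_true, cond_false, Sum.elim_inr, id, pow_one, star_sub,
          star_smul, star_mul, hu, Complex.star_def, Complex.conj_ofReal,
          Unitization.inr_sub, Unitization.inr_smul, Unitization.inr_mul, mul_sub, mul_one,
          mul_smul_comm, smul_sub]
        abel
      · refine tendsto_const_nhds.congr fun n => ?_
        simp only [damp, letterDegree, h, if_true, cond_true, Sum.elim_inr, id, pow_one, star_sub,
          star_smul, star_mul, hu, Complex.star_def, Complex.conj_ofReal,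
          Unitization.inr_sub, Unitization.inr_smul, Unitization.inr_mul, mul_sub, mul_one,
          mul_smul_comm, sub_self]
    · refine tendsto_const_nhds.congr fun n => ?_
      simp [damp, letterDegree, h]

/-- The unitized map preserves scalar parts, so its kernel lies in `B`; this brings the excesses
down from the unitization to ker ρ. -/
lemma inr_snd_of_starMap_eq_zero (ρ : B →⋆ₙₐ[ℂ] C) {g : Unitization ℂ B}
    (hg : Unitization.starMap ρ g = 0) : ((g.snd : B) : Unitization ℂ B) = g ∧ ρ g.snd = 0 := by
  have h : Unitization.starMap ρ g = Unitization.inl g.fst + ((ρ g.snd : C) : Unitization ℂ C) := by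
    conv_lhs => rw [← Unitization.inl_fst_add_inr_snd_eq g]
    rw [map_add, Unitization.starMap_inr, Unitization.starMap_inl]
    rfl
  rw [hg] at h
  have h1 := congrArg (fun z : Unitization ℂ C => z.fst) h
  have h2 := congrArg (fun z : Unitization ℂ C => z.snd) h
  simp only [Unitization.fst_zero, Unitization.fst_add, Unitization.fst_inl, Unitization.fst_inr,
    add_zero, Unitization.snd_zero, Unitization.snd_add, Unitization.snd_inl, Unitization.snd_inr,
    zero_add] at h1 h2
  refine ⟨?_, h2.symm⟩
  ext <;> simp [← h1]

/-- Damping by an element of the kernel brings the norms of homogeneous polynomials down to about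
the bound that holds in the quotient. -/
lemma exists_damp {r J : ℕ} (ρ : B →⋆ₙₐ[ℂ] C) (left : Bool) {p : Fin J → NCStarPoly s}
    {d : Fin J → ℕ} (hd : ∀ j, 1 ≤ d j) (hp : ∀ j, IsHomogeneousInFirst r (d j) (p j))
    {b : Fin s → B} {ε δ t η : ℝ} (hε : 0 < ε) (hδ : 0 < δ) (ht0 : 0 ≤ t) (ht1 : t ≤ 1)
    (ht : (1 - t) * (ε + δ) ≤ ε) (hb : ∀ j, ‖eval b (p j)‖ ≤ ε + δ)
    (hρb : ∀ j, ‖eval (fun k => ρ (b k)) (p j)‖ ≤ ε) (hη : 0 < η) :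
    ∃ u : B, ρ u = 0 ∧ 0 ≤ u ∧ ‖u‖ ≤ 1 ∧ ∀ j, ‖eval (damp left r t u b) (p j)‖ ≤ ε + η := by
  let g j := excess ε (eval b (p j))
  have hg j : (((g j).snd : B) : Unitization ℂ B) = g j ∧ ρ (g j).snd = 0 := by
    refine inr_snd_of_starMap_eq_zero ρ (map_excess_eq_zero _ hε.le ?_)
    rw [← eval_comp]
    exact hρb j
  obtain ⟨u, hu, huF, huG⟩ := exists_quasicentral_seq ρ
    (F := Set.range b ∪ Set.range fun k => star (b k)) (G := Set.range fun j => (g j).snd)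
    ((Set.finite_range _).union (Set.finite_range _)) (Set.finite_range _)
    (by rintro _ ⟨j, rfl⟩; exact (hg j).2)
  have hus n : star (u n) = u n := (IsSelfAdjoint.of_nonneg (hu n).2.1).star_eq
  set v : ℕ → Unitization ℂ B := fun n => (u n : Unitization ℂ B)
  have hv n : 0 ≤ v n ∧ ‖v n‖ ≤ 1 :=
    ⟨Unitization.inr_nonneg_iff.2 (hu n).2.1, (Unitization.norm_inr _).trans_le (hu n).2.2⟩
  set V : ℕ → Unitization ℂ B := fun n => 1 - (t : ℂ) • v n with hVdef
  have hV n : ‖V n‖ ≤ 1 := by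
    have h1 : v n ≤ 1 := (CStarAlgebra.norm_le_one_iff_of_nonneg _ (hv n).1).1 (hv n).2
    have h2 : t • v n ≤ v n := by
      simpa using smul_le_smul_of_nonneg_right ht1 (hv n).1
    have h3 : 0 ≤ t • v n := smul_nonneg ht0 (hv n).1
    have h4 : V n = 1 - t • v n := by rw [hVdef]; simp only [Complex.coe_smul]
    rw [h4, CStarAlgebra.norm_le_one_iff_of_nonneg _ (sub_nonneg.2 (h2.trans h1))]
    exact sub_le_self _ h3
  have hc k := huF (b k) (Or.inl ⟨k, rfl⟩)
  have hc' k := huF (star (b k)) (Or.inr ⟨k, rfl⟩)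
  have hcomm (l : Fin s ⊕ Fin s) :
      Tendsto (fun n => V n * eval b (ι ℂ l) - eval b (ι ℂ l) * V n) atTop (𝓝 0) := by
    have key (a : B) (ha : Tendsto (fun n => u n * a - a * u n) atTop (𝓝 0)) :
        Tendsto (fun n => V n * (a : Unitization ℂ B) - (a : Unitization ℂ B) * V n)
          atTop (𝓝 0) := by
      have h1 := ((Unitization.isometry_inr (𝕜 := ℂ) (A := B)).continuous.tendsto 0).comp ha
      have h2 := (h1.const_smul (t : ℂ)).neg
      rw [Unitization.inr_zero, smul_zero, neg_zero] at h2
      refine h2.congr fun n => ?_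
      simp only [hVdef, v, Function.comp_apply, Unitization.inr_sub, Unitization.inr_mul, sub_mul,
        mul_sub, one_mul, mul_one, smul_mul_assoc, mul_smul_comm, smul_sub]
      abel
    rcases l with k | k
    · simpa only [eval_ι_inl] using key _ (hc k)
    · simpa only [eval_ι_inr] using key _ (hc' k)
  have hev : ∀ᶠ n in atTop, ∀ j, ‖eval (damp left r t (u n) b) (p j)‖ ≤ ε + η := by
    refine eventually_all.2 fun j => ?_
    have h1 := (tendsto_eval_of_isHomogeneousInFirst hV hcomm
      (tendsto_damp_letter left r t hus b hc hc') (hp j)).norm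
    rw [norm_zero] at h1
    have h2 : Tendsto (fun n => v n * g j) atTop (𝓝 (g j)) := by
      have := ((Unitization.isometry_inr (𝕜 := ℂ) (A := B)).continuous.tendsto _).comp
        (huG _ ⟨j, rfl⟩)
      rw [(hg j).1] at this
      refine this.congr fun n => ?_
      rw [Function.comp_apply, Unitization.inr_mul, (hg j).1]
    filter_upwards [h1.eventually (eventually_le_nhds (half_pos hη)),
      eventually_norm_mul_one_sub_le hε hδ (hb j) ht0 ht1 ht hv h2 (half_pos hη)] with n h3 h4
    have h5 : ‖eval b (p j) * V n ^ d j‖ ≤ ε + η / 2 := by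
      -- One factor V reduces the norm; the other d_j - 1 are only used as contractions.
      obtain ⟨m, hm⟩ := Nat.exists_eq_add_of_le (hd j)
      rw [hm, pow_add, pow_one, ← mul_assoc]
      refine (norm_mul_le _ _).trans ((mul_le_of_le_one_right (norm_nonneg _) ?_).trans h4)
      exact (norm_pow_le _ _).trans (pow_le_one₀ (norm_nonneg _) (hV n))
    calc ‖eval (damp left r t (u n) b) (p j)‖
        = ‖(eval (damp left r t (u n) b) (p j) - eval b (p j) * V n ^ d j) +
            eval b (p j) * V n ^ d j‖ := by rw [sub_add_cancel]
      _ ≤ η / 2 + (ε + η / 2) := (norm_add_le _ _).trans (add_le_add h3 h5)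
      _ = ε + η := by ring
  obtain ⟨n, hn⟩ := hev.exists
  exact ⟨u n, (hu n).1, (hu n).2.1, (hu n).2.2, hn⟩

/-- Tuples in a closed set of contractions that is stable under damping can be changed, modulo the
kernel, so that the bounds on homogeneous polynomials in the quotient hold for the tuple itself. -/
theorem exists_lift_norm_eval_le {r J : ℕ} (ρ : B →⋆ₙₐ[ℂ] C) (left : Bool)
    {p : Fin J → NCStarPoly s} {d : Fin J → ℕ} (hd : ∀ j, 1 ≤ d j)
    (hp : ∀ j, IsHomogeneousInFirst r (d j) (p j)) {ε : ℝ} (hε : 0 < ε)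
    {Q : Set (Fin s → B)} (hQ : IsClosed Q) (hQ1 : ∀ b ∈ Q, ∀ k, ‖b k‖ ≤ 1)
    (hQd : ∀ b ∈ Q, ∀ (u : B) (t : ℝ), 0 ≤ u → ‖u‖ ≤ 1 → 0 ≤ t → t ≤ 1 → damp left r t u b ∈ Q)
    {b : Fin s → B} (hbQ : b ∈ Q) (hb : ∀ j, ‖eval (fun k => ρ (b k)) (p j)‖ ≤ ε) :
    ∃ b' ∈ Q, (∀ k, ρ (b' k) = ρ (b k)) ∧ ∀ j, ‖eval b' (p j)‖ ≤ ε := by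
  set D : ℝ := ∑ j, ‖eval b (p j)‖ + 1
  have hD : 0 < D := by positivity
  let Inv (n : ℕ) (z : Fin s → B) : Prop :=
    z ∈ Q ∧ (∀ k, ρ (z k) = ρ (b k)) ∧ ∀ j, ‖eval z (p j)‖ ≤ ε + D / 2 ^ n
  have hstep (n : ℕ) (z : {z // Inv n z}) :
      ∃ z' : {z // Inv (n + 1) z}, dist z.1 z'.1 ≤ (2 * D / ε) / 2 / 2 ^ n := by
    obtain ⟨z, hz1, hz2, hz3⟩ := z
    set δ := D / 2 ^ n with hδdef
    have hδ : 0 < δ := by positivity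
    -- The value with (1 - t)(ε + δ) = ε; it is at most δ / ε, which makes the successive moves
    -- summable.
    set t := δ / (ε + δ) with htdef
    have ht0 : 0 ≤ t := by positivity
    have ht1 : t ≤ 1 := by rw [htdef, div_le_one (by positivity)]; linarith
    have htε : (1 - t) * (ε + δ) ≤ ε := by
      rw [htdef]; field_simp; linarith
    obtain ⟨u, hu1, hu2, hu3, hu4⟩ := exists_damp ρ left hd hp (b := z) (η := D / 2 ^ (n + 1))
      hε hδ ht0 ht1 htε hz3 (fun j => by simpa only [hz2] using hb j) (by positivity)
    refine ⟨⟨damp left r t u z, hQd z hz1 u t hu2 hu3 ht0 ht1,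
      fun k => (map_damp ρ left r t hu1 z k).trans (hz2 k), hu4⟩, ?_⟩
    refine (dist_pi_le_iff (by positivity)).2 fun k => ?_
    rw [dist_comm, dist_eq_norm]
    refine (norm_damp_sub_le left r ht0 hu3 z k).trans ?_
    calc t * ‖z k‖ ≤ t * 1 := by gcongr; exact hQ1 z hz1 k
      _ ≤ δ / ε := by
        rw [mul_one, htdef]
        gcongr
        linarith
      _ = (2 * D / ε) / 2 / 2 ^ n := by rw [hδdef]; field_simp
  choose next hnext using hstep
  let f (n : ℕ) : {z // Inv n z} := Nat.rec
    ⟨b, hbQ, fun _ => rfl, fun j => by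
      have := Finset.single_le_sum (f := fun j => ‖eval b (p j)‖) (fun _ _ => norm_nonneg _)
        (Finset.mem_univ j)
      rw [pow_zero, div_one]
      linarith⟩ next n
  have hf (n : ℕ) : dist (f n).1 (f (n + 1)).1 ≤ (2 * D / ε) / 2 / 2 ^ n := hnext n (f n)
  obtain ⟨z, hz⟩ := cauchySeq_tendsto_of_complete (cauchySeq_of_le_geometric_two hf)
  refine ⟨z, hQ.mem_of_tendsto hz (Eventually.of_forall fun n => (f n).2.1), fun k => ?_,
    fun j => ?_⟩
  · have h1 : Tendsto (fun n => ρ ((f n).1 k)) atTop (𝓝 (ρ (z k))) :=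
      ((continuous_starHom ρ).tendsto _).comp (((continuous_apply k).tendsto z).comp hz)
    simp only [(f _).2.2.1 k] at h1
    exact tendsto_nhds_unique h1 tendsto_const_nhds |>.symm ▸ rfl
  · have h1 : Tendsto (fun n => ‖eval (f n).1 (p j)‖) atTop (𝓝 ‖eval z (p j)‖) :=
      (((continuous_eval (p j)).tendsto z).comp hz).norm
    have h2 : Tendsto (fun n : ℕ => ε + D / 2 ^ n) atTop (𝓝 (ε + 0)) := by
      refine tendsto_const_nhds.add ?_
      have := (tendsto_pow_atTop_nhds_zero_of_lt_one (r := (1 / 2 : ℝ)) (by norm_num)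
        (by norm_num)).const_mul D
      rw [mul_zero] at this
      refine this.congr fun n => ?_
      rw [one_div, inv_pow, div_eq_mul_inv]
    rw [add_zero] at h2
    exact le_of_tendsto_of_tendsto' h1 h2 fun n => (f n).2.2.2 j

end Damping

end NCSemialg

namespace NCSemialg

open NCStarPoly FreeAlgebra Filter Topology

/-- A homogeneous polynomial of positive degree has no constant term. -/
lemma algebraMapInv_eq_zero_of_isHomogeneousInFirst {s r d : ℕ} (hd : 1 ≤ d) {p : NCStarPoly s}
    (hp : IsHomogeneousInFirst r d p) : algebraMapInv p = 0 := by
  have h : (algebraMapInv : NCStarPoly s →ₐ[ℂ] ℂ).comp (scaleFirst r 0) = algebraMapInv := by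
    refine FreeAlgebra.hom_ext (funext ?_)
    rintro (k | k) <;> by_cases h : (k : ℕ) < r <;> simp [scaleFirst, algebraMapInv, h]
  have h1 := DFunLike.congr_fun h p
  rw [AlgHom.comp_apply, hp 0, Complex.ofReal_zero, zero_pow (by omega), zero_smul, map_zero] at h1
  exact h1.symm

/-! ### Stability under damping, and the three families of relations -/

section Stability

attribute [local instance] CStarAlgebra.spectralOrder CStarAlgebra.spectralOrderedRing

variable {s : ℕ} {B : Type u} [NonUnitalCStarAlgebra B]

/-- Left damping by V places V² ≤ 1 between b_k^* and b_k, so each summand of the column sum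
decreases separately, although only some variables are damped. -/
lemma star_damp_mul_damp_le (r : ℕ) {t : ℝ} (ht0 : 0 ≤ t) (ht1 : t ≤ 1) {u : B} (hu0 : 0 ≤ u)
    (hu1 : ‖u‖ ≤ 1) (b : Fin s → B) (k : Fin s) :
    star (damp true r t u b k) * damp true r t u b k ≤ star (b k) * b k := by
  by_cases h : (k : ℕ) < r
  swap
  · simp [damp, h]
  rw [← Unitization.inr_le_iff _ _ (IsSelfAdjoint.star_mul_self _) (IsSelfAdjoint.star_mul_self _)]
  set v : Unitization ℂ B := (u : Unitization ℂ B)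
  have hv0 : 0 ≤ v := Unitization.inr_nonneg_iff.2 hu0
  have hv1 : v ≤ 1 := (CStarAlgebra.norm_le_one_iff_of_nonneg _ hv0).1
    ((Unitization.norm_inr _).trans_le hu1)
  have h2 : t • v ≤ v := by simpa using smul_le_smul_of_nonneg_right ht1 hv0
  have h3 : 0 ≤ t • v := smul_nonneg ht0 hv0
  set V := 1 - t • v with hV
  have hV0 : 0 ≤ V := sub_nonneg.2 (h2.trans hv1)
  have hVV : V * V ≤ 1 := by
    have := CStarAlgebra.pow_antitone hV0 (sub_le_self _ h3) (Nat.zero_le 2)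
    simpa [pow_two] using this
  have hb : ((damp true r t u b k : B) : Unitization ℂ B) = V * (b k : Unitization ℂ B) := by
    simp only [damp, h, if_true, cond_true, Unitization.inr_sub, Unitization.inr_smul,
      Unitization.inr_mul, hV, sub_mul, one_mul, Complex.coe_smul, smul_mul_assoc, v]
  have := star_left_conjugate_le_conjugate hVV (b k : Unitization ℂ B)
  rw [Unitization.inr_mul, Unitization.inr_mul, Unitization.inr_star, Unitization.inr_star, hb,
    star_mul, (IsSelfAdjoint.of_nonneg hV0).star_eq]
  calc _ = star (b k : Unitization ℂ B) * (V * V) * (b k : Unitization ℂ B) := by noncomm_ring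
    _ ≤ star (b k : Unitization ℂ B) * 1 * (b k : Unitization ℂ B) := this
    _ = _ := by rw [mul_one]

/-- Adjoints exchange the two sides, which reduces the row ball to the column estimates. -/
lemma star_damp (r : ℕ) (t : ℝ) {u : B} (hu : star u = u) (b : Fin s → B) (k : Fin s) :
    star (damp false r t u b k) = damp true r t u (fun k => star (b k)) k := by
  by_cases h : (k : ℕ) < r <;> simp [damp, h, hu, -Complex.coe_smul]

lemma norm_sum_star_damp_le (r : ℕ) {t : ℝ} (ht0 : 0 ≤ t) (ht1 : t ≤ 1) {u : B} (hu0 : 0 ≤ u)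
    (hu1 : ‖u‖ ≤ 1) (b : Fin s → B) :
    ‖∑ k, star (damp true r t u b k) * damp true r t u b k‖ ≤ ‖∑ k, star (b k) * b k‖ :=
  CStarAlgebra.norm_le_norm_of_nonneg_of_le
    (Finset.sum_nonneg fun _ _ => star_mul_self_nonneg _)
    (Finset.sum_le_sum fun k _ => star_damp_mul_damp_le r ht0 ht1 hu0 hu1 b k)

lemma norm_damp_le (r : ℕ) {t : ℝ} (ht0 : 0 ≤ t) (ht1 : t ≤ 1) {u : B} (hu0 : 0 ≤ u)
    (hu1 : ‖u‖ ≤ 1) (b : Fin s → B) (k : Fin s) : ‖damp true r t u b k‖ ≤ ‖b k‖ := by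
  have := CStarAlgebra.norm_le_norm_of_nonneg_of_le (star_mul_self_nonneg _)
    (star_damp_mul_damp_le r ht0 ht1 hu0 hu1 b k)
  rw [CStarRing.norm_star_mul_self, CStarRing.norm_star_mul_self] at this
  exact abs_le_of_sq_le_sq' (by simpa [pow_two] using this) (norm_nonneg _) |>.2

lemma norm_le_one_of_columnContraction {b : Fin s → B} (hb : ‖∑ k, star (b k) * b k‖ ≤ 1)
    (k : Fin s) : ‖b k‖ ≤ 1 := by
  have h : star (b k) * b k ≤ ∑ k, star (b k) * b k :=
    Finset.single_le_sum (f := fun k => star (b k) * b k)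
      (fun k _ => star_mul_self_nonneg (b k)) (Finset.mem_univ k)
  have := (CStarAlgebra.norm_le_norm_of_nonneg_of_le (star_mul_self_nonneg _) h).trans hb
  rw [CStarRing.norm_star_mul_self] at this
  nlinarith [norm_nonneg (b k)]

/-- Relations `R` that hold on a closed set of contractive tuples, lift along surjections, and are
stable under damping stay projective when bounds on homogeneous polynomials are added. -/
theorem universalCStarAlgebraIsProjective_of_damp {s r J : ℕ} {p : Fin J → NCStarPoly s}
    {d : Fin J → ℕ} (hd : ∀ j, 1 ≤ d j) (hp : ∀ j, IsHomogeneousInFirst r (d j) (p j)) {ε : ℝ}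
    (hε : 0 < ε) {R : CStarRelation.{u} s} {K : Type*} {q : K → NCStarPoly s}
    (hq : ∀ i, algebraMapInv (q i) = 0)
    (hR : ∀ (A : Type u) [NonUnitalCStarAlgebra A] (x : Fin s → A),
      R A x ↔ ∀ i, ‖eval x (q i)‖ ≤ 1)
    (hR1 : ∀ (A : Type u) [NonUnitalCStarAlgebra A] (x : Fin s → A), R A x → ∀ k, ‖x k‖ ≤ 1)
    (hlift : ∀ (B C : Type u) [NonUnitalCStarAlgebra B] [NonUnitalCStarAlgebra C]
      (ρ : B →⋆ₙₐ[ℂ] C), Function.Surjective ρ → ∀ y : Fin s → C, R C y →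
        ∃ z : Fin s → B, R B z ∧ ∀ k, ρ (z k) = y k)
    (left : Bool)
    (hdamp : ∀ (B : Type u) [NonUnitalCStarAlgebra B] (b : Fin s → B), R B b →
      ∀ (u : B) (t : ℝ), 0 ≤ u → ‖u‖ ≤ 1 → 0 ≤ t → t ≤ 1 → R B (damp left r t u b)) :
    UniversalCStarAlgebraIsProjective.{u} (fun A _ x => R A x ∧ polyRelation p ε A x) := by
  set q' : K ⊕ Fin J → NCStarPoly s := Sum.elim q p with hq'def
  set c' : K ⊕ Fin J → ℝ := Sum.elim (fun _ => 1) (fun _ => ε) with hc'def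
  have hiff (A : Type u) [NonUnitalCStarAlgebra A] (x : Fin s → A) :
      normRelation q' c' A x ↔ R A x ∧ polyRelation p ε A x := by
    rw [hR, normRelation, Sum.forall]
    rfl
  have hEq : (fun A _ x => R A x ∧ polyRelation p ε A x : CStarRelation.{u} s) =
      normRelation q' c' := by
    funext A _ x
    exact propext (hiff A x).symm
  have hq' : ∀ i, algebraMapInv (q' i) = 0 := by
    rintro (i | j)
    · exact hq i
    · exact algebraMapInv_eq_zero_of_isHomogeneousInFirst (hd j) (hp j)
  have hc' : ∀ i, 0 ≤ c' i := by
    rintro (i | j)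
    · exact zero_le_one
    · exact hε.le
  rw [hEq]
  refine ⟨exists_isUniversalCStarAlgebra hq' hc' fun A _ x hx => hR1 A x ((hiff A x).1 hx).1, ?_⟩
  refine isProjectiveCStarAlgebra_of_lifting hq' fun B C _ _ ρ hρ y hy => ?_
  obtain ⟨hy1, hy2⟩ := (hiff C y).1 hy
  obtain ⟨z, hz, hzy⟩ := hlift B C ρ hρ y hy1
  -- Closedness, needed for the limit tuple, comes from expressing `R` by norm bounds on
  -- polynomials, whose values depend continuously on the tuple.
  have hclosed : IsClosed {b : Fin s → B | R B b} := by
    simp only [hR, Set.ofPred_forall]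
    exact isClosed_iInter fun i => isClosed_le (continuous_eval (q i)).norm continuous_const
  have hzy' : (fun k => ρ (z k)) = y := funext hzy
  obtain ⟨b, hb, hbz, hbp⟩ := exists_lift_norm_eval_le ρ left hd hp hε hclosed
    (fun b hb => hR1 B b hb) (fun b hb => hdamp B b hb) hz (by rw [hzy']; exact hy2)
  exact ⟨b, (hiff B b).2 ⟨hb, hbp⟩, fun k => (hbz k).trans (hzy k)⟩

lemma algebraMapInv_ι (l : Fin s ⊕ Fin s) : algebraMapInv (ι ℂ l) = 0 := by
  simp [algebraMapInv]

variable {r J : ℕ} {p : Fin J → NCStarPoly s} {d : Fin J → ℕ} {ε : ℝ}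

theorem squareRelation_isProjective (hd : ∀ j, 1 ≤ d j)
    (hp : ∀ j, IsHomogeneousInFirst r (d j) (p j)) (hε : 0 < ε) :
    UniversalCStarAlgebraIsProjective.{u} (s := s)
      (fun A _ x => squareRelation s A x ∧ polyRelation p ε A x) := by
  refine universalCStarAlgebraIsProjective_of_damp hd hp hε (R := squareRelation s)
    (q := fun k => ι ℂ (Sum.inl k)) (fun k => algebraMapInv_ι _) (fun A _ x => ?_)
    (fun A _ x hx => hx) (fun B C _ _ ρ hρ y hy => ?_) true
    (fun B _ b hb u t hu0 hu1 ht0 ht1 k => (norm_damp_le r ht0 ht1 hu0 hu1 b k).trans (hb k))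
  · simp [squareRelation, Unitization.norm_inr]
  · choose z hz hz1 using fun k => exists_contraction_lift ρ hρ (hy k)
    exact ⟨z, hz1, hz⟩

theorem rowBallRelation_isProjective (hd : ∀ j, 1 ≤ d j)
    (hp : ∀ j, IsHomogeneousInFirst r (d j) (p j)) (hε : 0 < ε) :
    UniversalCStarAlgebraIsProjective.{u} (s := s)
      (fun A _ x => rowBallRelation s A x ∧ polyRelation p ε A x) := by
  refine universalCStarAlgebraIsProjective_of_damp hd hp hε (R := rowBallRelation s)
    (q := fun _ : Unit => ∑ k, ι ℂ (Sum.inl k) * ι ℂ (Sum.inr k))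
    (fun _ => by simp [algebraMapInv_ι]) (fun A _ x => ?_)
    (fun A _ x hx k => ?_) (fun B C _ _ ρ hρ y hy => ?_) false
    (fun B _ b hb u t hu0 hu1 ht0 ht1 => ?_)
  · rw [forall_const, map_sum, rowBallRelation, ← Unitization.norm_inr (𝕜 := ℂ),
      ← Unitization.inrHom_apply ℂ, map_sum]
    simp
  · rw [← norm_star]
    exact norm_le_one_of_columnContraction (b := fun k => star (x k))
      (by simpa [rowBallRelation] using hx) k
  · obtain ⟨z, hz, hz1⟩ := exists_rowContraction_lift ρ hρ hy
    exact ⟨z, hz1, hz⟩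
  · have hus := (IsSelfAdjoint.of_nonneg hu0).star_eq
    have h := norm_sum_star_damp_le r ht0 ht1 hu0 hu1 (fun k => star (b k))
    simp only [← star_damp r t hus, star_star] at h
    exact h.trans hb

theorem columnBallRelation_isProjective (hd : ∀ j, 1 ≤ d j)
    (hp : ∀ j, IsHomogeneousInFirst r (d j) (p j)) (hε : 0 < ε) :
    UniversalCStarAlgebraIsProjective.{u} (s := s)
      (fun A _ x => columnBallRelation s A x ∧ polyRelation p ε A x) := by
  refine universalCStarAlgebraIsProjective_of_damp hd hp hε (R := columnBallRelation s)
    (q := fun _ : Unit => ∑ k, ι ℂ (Sum.inr k) * ι ℂ (Sum.inl k))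
    (fun _ => by simp [algebraMapInv_ι]) (fun A _ x => ?_)
    (fun A _ x hx k => norm_le_one_of_columnContraction hx k)
    (fun B C _ _ ρ hρ y hy => ?_) true
    (fun B _ b hb u t hu0 hu1 ht0 ht1 =>
      (norm_sum_star_damp_le r ht0 ht1 hu0 hu1 b).trans hb)
  · rw [forall_const, map_sum, columnBallRelation, ← Unitization.norm_inr (𝕜 := ℂ),
      ← Unitization.inrHom_apply ℂ, map_sum]
    simp
  · obtain ⟨z, hz, hz1⟩ := exists_columnContraction_lift ρ hρ hy
    exact ⟨z, hz1, hz⟩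

end Stability

end NCSemialg

theorem theorem5p1 (s r J : ℕ) (hr : 1 ≤ r) (hrs : r ≤ s)
    (p : Fin J → NCSemialg.NCStarPoly s) (d : Fin J → ℕ) (hd : ∀ j, 1 ≤ d j)
    (hp : ∀ j, NCSemialg.NCStarPoly.IsHomogeneousInFirst r (d j) (p j))
    (ε : ℝ) (hε : 0 < ε) :
    NCSemialg.UniversalCStarAlgebraIsProjective.{u} (s := s)
        (fun A _ x => NCSemialg.squareRelation s A x ∧ NCSemialg.polyRelation p ε A x) ∧
      NCSemialg.UniversalCStarAlgebraIsProjective.{u} (s := s)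
        (fun A _ x => NCSemialg.rowBallRelation s A x ∧ NCSemialg.polyRelation p ε A x) ∧
      NCSemialg.UniversalCStarAlgebraIsProjective.{u} (s := s)
        (fun A _ x => NCSemialg.columnBallRelation s A x ∧ NCSemialg.polyRelation p ε A x) :=
  ⟨NCSemialg.squareRelation_isProjective hd hp hε, NCSemialg.rowBallRelation_isProjective hd hp hε,
    NCSemialg.columnBallRelation_isProjective hd hp hε⟩
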